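/- Let $T^k=(S^1)^k$ and let $M$ be a smooth manifold (Hausdorff, second countable, finite-dimensional, without boundary, not necessarily compact) with a smooth action of $T^k$. The action is called locally standard if each orbit has an invariant open neighbourhood $W$ with a diffeomorphism $\varphi\colon W\to\mathbb{C}^n\times T^{k-n}\times\mathbb{R}^m$ (a standard chart; $n$ and $m$ may depend on the orbit) that is equivariant with respect to some splitting $T^k\cong T^n\times T^{k-n}$, where $T^n$ acts on $\mathbb{C}^n$ by coordinatewise multiplication, $T^{k-n}$ acts on itself by multiplication, and $T^k$ acts trivially on $\mathbb{R}^m$. Let $\pi\colon M\to M/T^k$ be the orbit map. Via $(z,t,y)\mapsto(|z_1|^2,\dots,|z_n|^2,y)$ a standard chart identifies the open set $\pi(W)\subset M/T^k$ with $\mathbb{R}_{\ge 0}^n\times\mathbb{R}^m$; let $s_0(x,y)=(\sqrt{x_1},\dots,\sqrt{x_n},1,y)$ be the standard section in these coordinates. A section $s\colon M/T^k\to M$ of $\pi$ is called regular if for every point $p\in M/T^k$ and every standard chart with $p\in\pi(W)$ there are an open neighbourhood $V$ of $p$ in $\pi(W)$ and a map $f\colon V\to T^k$, smooth up to the boundary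 as a map on an open subset of $\mathbb{R}_{\ge0}^n\times\mathbb{R}^m$, such that $s(x,y)=f(x,y)\cdot s_0(x,y)$ on $V$ in the coordinates of the chart. Theorem. Let $M$ be a locally standard $T^k$-manifold whose orbit map $\pi\colon M\to M/T^k$ has a continuous section. Then $\pi$ has a continuous section that is regular. -/

import Mathlib

open scoped Manifold ContDiff

noncomputable section

namespace LocallyStandardTorus

/-- The compact torus `T^k`. -/
abbrev Torus (k : ℕ) : Type := Fin k → Circle

/-- The model with corners of `T^k` with its product smooth structure. -/
abbrev torusModel (k : ℕ) :
    ModelWithCorners ℝ (Fin k → EuclideanSpace ℝ (Fin 1))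
      (ModelPi fun _ : Fin k => EuclideanSpace ℝ (Fin 1)) :=
  ModelWithCorners.pi fun _ : Fin k => 𝓡 1

/-- The local model `ℂ^n × T^l × ℝ^m`. -/
abbrev StdSpace (n l m : ℕ) : Type := (Fin n → ℂ) × (Torus l × (Fin m → ℝ))

/-- The model with corners of `ℂ^n × T^l × ℝ^m` with its product smooth structure (over `ℝ`). -/
abbrev stdModel (n l m : ℕ) :=
  (𝓘(ℝ, Fin n → ℂ)).prod ((torusModel l).prod 𝓘(ℝ, Fin m → ℝ))

/-- The standard action of `T^n × T^l` on `ℂ^n × T^l × ℝ^m`: `T^n` rotates the coordinates of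
`ℂ^n`, `T^l` acts on itself by multiplication, and the action on `ℝ^m` is trivial. -/
def stdAct {n l m : ℕ} (t : Torus n × Torus l) (v : StdSpace n l m) : StdSpace n l m :=
  (fun i => (t.1 i : ℂ) * v.1 i, (t.2 * v.2.1, v.2.2))

/-- The closed sector `ℝ_{≥0}^n × ℝ^m`, the orbit space of `ℂ^n × T^l × ℝ^m` through the map
`(z, t, y) ↦ (|z_1|^2, …, |z_n|^2, y)`. -/
def sector (n m : ℕ) : Set ((Fin n → ℝ) × (Fin m → ℝ)) := {q | ∀ i, 0 ≤ q.1 i}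

/-- The standard section `(x, y) ↦ (√x_1, …, √x_n, 1, y)`. -/
def stdSection {n l m : ℕ} (q : (Fin n → ℝ) × (Fin m → ℝ)) : StdSpace n l m :=
  (fun i => ((Real.sqrt (q.1 i) : ℝ) : ℂ), (1, q.2))

/-- The orbit space `M / T^k` (with the quotient topology). -/
abbrev OrbitSpace (k : ℕ) (M : Type*) [MulAction (Torus k) M] : Type _ :=
  Quotient (MulAction.orbitRel (Torus k) M)

/-- The orbit map `π : M → M / T^k`. -/
def orbitMap (k : ℕ) {M : Type*} [MulAction (Torus k) M] (x : M) : OrbitSpace k M :=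
  Quotient.mk (MulAction.orbitRel (Torus k) M) x

/-- A continuous section of the orbit map. -/
structure IsOrbitSection (k : ℕ) {M : Type*} [TopologicalSpace M] [MulAction (Torus k) M]
    (s : OrbitSpace k M → M) : Prop where
  continuous : Continuous s
  orbitMap_apply : ∀ p, orbitMap k (s p) = p

section Manifold

variable {E : Type*} [NormedAddCommGroup E] [NormedSpace ℝ E] {H : Type*} [TopologicalSpace H]
  (I : ModelWithCorners ℝ E H) (k : ℕ) (M : Type*) [TopologicalSpace M] [ChartedSpace H M]
  [MulAction (Torus k) M]

/-- A standard chart of a `T^k`-manifold `M`: a diffeomorphism from an invariant open subset of `M`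
onto some `ℂ^n × T^l × ℝ^m`, equivariant with respect to a splitting `T^k ≅ T^n × T^l` of
topological groups (which forces `l = k - n`) and the standard action. -/
structure StandardChart where
  n : ℕ
  l : ℕ
  m : ℕ
  split : Torus k ≃ₜ* Torus n × Torus l
  chart : OpenPartialHomeomorph M (StdSpace n l m)
  smul_mem_source : ∀ (t : Torus k) (x : M), x ∈ chart.source → t • x ∈ chart.source
  target_eq : chart.target = Set.univ
  contMDiffOn_chart : ContMDiffOn I (stdModel n l m) ∞ chart chart.source
  contMDiff_symm : ContMDiff (stdModel n l m) I ∞ chart.symm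
  map_smul : ∀ (t : Torus k) (x : M), x ∈ chart.source → chart (t • x) = stdAct (split t) (chart x)

/-- A smooth `T^k`-action on `M` is locally standard if each orbit has an invariant open
neighbourhood which is the domain of a standard chart. -/
structure IsLocallyStandard : Prop where
  contMDiff_smul : ContMDiff ((torusModel k).prod I) I ∞ fun p : Torus k × M => p.1 • p.2
  exists_chart : ∀ x : M, ∃ c : StandardChart I k M, x ∈ c.chart.source

variable {I k M}

/-- The standard section of the orbit map over the domain of a standard chart, in the
coordinates `(x, y) ∈ ℝ_{≥0}^n × ℝ^m` of the orbit space. -/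
def StandardChart.localSection (c : StandardChart I k M)
    (q : (Fin c.n → ℝ) × (Fin c.m → ℝ)) : M :=
  c.chart.symm (stdSection q)

/-- The point of `M / T^k` with coordinates `q ∈ ℝ_{≥0}^n × ℝ^m` in a standard chart. -/
def StandardChart.orbitPoint (c : StandardChart I k M)
    (q : (Fin c.n → ℝ) × (Fin c.m → ℝ)) : OrbitSpace k M :=
  orbitMap k (c.localSection q)

variable (I) in
/-- A section `s` is regular at `p` if in every standard chart around `p` one can write
`s(x, y) = f(x, y) • s₀(x, y)` near `p`, where `s₀` is the standard section and `f` is a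
`T^k`-valued map that is smooth (up to the boundary of the sector) near `p`. -/
def IsRegularAt (s : OrbitSpace k M → M) (p : OrbitSpace k M) : Prop :=
  ∀ (c : StandardChart I k M), ∀ q₀ ∈ sector c.n c.m, c.orbitPoint q₀ = p →
    ∃ V : Set ((Fin c.n → ℝ) × (Fin c.m → ℝ)), IsOpen V ∧ q₀ ∈ V ∧
      ∃ f : (Fin c.n → ℝ) × (Fin c.m → ℝ) → Torus k,
        ContMDiffOn 𝓘(ℝ, (Fin c.n → ℝ) × (Fin c.m → ℝ)) (torusModel k) ∞ f
          (V ∩ sector c.n c.m) ∧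
        ∀ q ∈ V ∩ sector c.n c.m, s (c.orbitPoint q) = f q • c.localSection q

variable (I) in
/-- A section is regular if it is regular at every point of the orbit space. -/
def IsRegular (s : OrbitSpace k M → M) : Prop :=
  ∀ p : OrbitSpace k M, IsRegularAt I s p

end Manifold

end LocallyStandardTorus

end

/-! Over the interior of the sector of a standard chart `c` the orbits are free. The interior is
convex, so the given section is `torusExp θ_c • s₀` there, with `θ_c` continuous and vector-valued.
At the boundary `θ_c` may have no limit. For two charts, however, `θ_a - θ_c` is smooth up to the
boundary, because it compares two standard sections, up to a locally constant element of the period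
lattice. Hence, if `ψ` is an average of the `θ_a` weighted by smooth bump functions on the orbit
space, then `θ_c - ψ` is smooth up to the boundary in every chart. Multiplying the section by
`torusExp (-ψ)` over the free orbits and extending by continuity gives a regular section
(`exists_isRegular_section`).

The main work is the comparison of standard sections (`StandardChart.exists_localSection_eq`).
Restricted to real points `(r, y)` of the slice of `c`, with `x = r²`, each complex or circle
coordinate `F` of another chart transforms by a character, so it has parities in those `r_i` that
vanish at the point. If `F ≠ 0` there, it is even in all of them. If `F = 0`, its differential is
nonzero, and equivariance makes it odd in exactly one `r_i` and even in the others. Hadamard's lemma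
then gives `F = r_i B` with `B` even and nonzero, and `r_i ≥ 0` does not change the argument.
Whitney's theorem (`contDiffOn_comp_sqrtMap`) turns smooth even functions of `r` into functions of
`x` smooth up to the boundary, so the argument of `F` is one too. -/

noncomputable section

namespace LocallyStandardTorus

open Set Filter Topology MeasureTheory

/-! ### Smooth dependence of integrals on parameters. -/

/-- The derivative of the integral is an integral of the same form with values in a space of linear
maps. The induction on `N` therefore leaves the target space free. -/
theorem contDiff_intervalIntegral_param {Z : Type} [NormedAddCommGroup Z] [NormedSpace ℝ Z]
    [FiniteDimensional ℝ Z] (N : ℕ) : ∀ {E : Type} [NormedAddCommGroup E] [NormedSpace ℝ E]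
    {K : ℝ × Z → E}, ContDiff ℝ ∞ K → ContDiff ℝ N fun q => ∫ u in (0 : ℝ)..1, K (u, q) := by
  have key : ∀ {E : Type} [NormedAddCommGroup E] [NormedSpace ℝ E]
    {K : ℝ × Z → E}, ContDiff ℝ ∞ K → ∀ q, HasFDerivAt (fun q => ∫ u in (0 : ℝ)..1, K (u, q))
      (∫ u in (0 : ℝ)..1, (fderiv ℝ K (u, q)).comp (ContinuousLinearMap.inr ℝ ℝ Z)) q := by
    intro E _ _ K hK q
    have : ProperSpace Z := FiniteDimensional.proper ℝ Z
    have hK' : Continuous fun w : ℝ × Z =>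
        (fderiv ℝ K w).comp (ContinuousLinearMap.inr ℝ ℝ Z) :=
      (hK.continuous_fderiv (by simp)).clm_comp_const _
    obtain ⟨C, hC⟩ := ((isCompact_uIcc (a := (0 : ℝ)) (b := 1)).prod
      (isCompact_closedBall q 1)).exists_bound_of_continuousOn hK'.continuousOn
    refine intervalIntegral.hasFDerivAt_integral_of_dominated_of_fderiv_le
      (F' := fun q u => (fderiv ℝ K (u, q)).comp (ContinuousLinearMap.inr ℝ ℝ Z))
      (bound := fun _ => C) (Metric.closedBall_mem_nhds q one_pos)
      (Eventually.of_forall fun x => ?_) ?_ ?_ ?_ ?_ ?_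
    · exact (hK.continuous.comp (by fun_prop : Continuous fun u : ℝ => (u, x))).aestronglyMeasurable
    · exact (hK.continuous.comp
        (by fun_prop : Continuous fun u : ℝ => (u, q))).intervalIntegrable _ _
    · exact (hK'.comp (by fun_prop : Continuous fun u : ℝ => (u, q))).aestronglyMeasurable
    · exact Eventually.of_forall fun u hu x hx => hC (u, x) ⟨uIoc_subset_uIcc hu, hx⟩
    · exact intervalIntegrable_const
    · exact Eventually.of_forall fun u _ x _ =>
        ((hK.differentiable (by simp) (u, x)).hasFDerivAt).comp x (hasFDerivAt_prodMk_right u x)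
  induction N with
  | zero =>
    intro E _ _ K hK
    exact contDiff_zero.2 (continuous_iff_continuousAt.2 fun q => (key hK q).continuousAt)
  | succ N ih =>
    intro E _ _ K hK
    refine contDiff_succ_iff_hasFDerivAt.2 ⟨_, ?_, key hK⟩
    exact ih (K := fun w => (fderiv ℝ K w).comp (ContinuousLinearMap.inr ℝ ℝ Z))
      ((hK.fderiv_right (by simp)).clm_comp contDiff_const)

/-! ### Hadamard's lemma with parities. -/

section Coordinates
variable {n m : ℕ}

/-- The basis vector of the `i`-th coordinate of the first factor. -/
def firstBasis (m : ℕ) (i : Fin n) : (Fin n → ℝ) × (Fin m → ℝ) := (Pi.single i 1, 0)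

/-- Multiplication of the `i`-th coordinate of the first factor by `u`. -/
def coordScale (i : Fin n) (u : ℝ) (q : (Fin n → ℝ) × (Fin m → ℝ)) :
    (Fin n → ℝ) × (Fin m → ℝ) :=
  q + ((u - 1) * q.1 i) • firstBasis m i

/-- The map `(x, y) ↦ (√x₁, …, √xₙ, y)`. -/
def sqrtMap (q : (Fin n → ℝ) × (Fin m → ℝ)) : (Fin n → ℝ) × (Fin m → ℝ) :=
  (fun i => Real.sqrt (q.1 i), q.2)

theorem coordScale_snd (i : Fin n) (u : ℝ) (q : (Fin n → ℝ) × (Fin m → ℝ)) :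
    (coordScale i u q).2 = q.2 := by
  simp [coordScale, firstBasis]

theorem coordScale_fst_self (i : Fin n) (u : ℝ) (q : (Fin n → ℝ) × (Fin m → ℝ)) :
    (coordScale i u q).1 i = u * q.1 i := by
  simp [coordScale, firstBasis]; ring

theorem coordScale_fst_ne {i j : Fin n} (h : j ≠ i) (u : ℝ) (q : (Fin n → ℝ) × (Fin m → ℝ)) :
    (coordScale i u q).1 j = q.1 j := by
  simp [coordScale, firstBasis, h]

theorem coordScale_one (i : Fin n) (q : (Fin n → ℝ) × (Fin m → ℝ)) : coordScale i 1 q = q := by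
  simp [coordScale]

theorem contDiff_coordScale (i : Fin n) :
    ContDiff ℝ ∞ fun w : ℝ × ((Fin n → ℝ) × (Fin m → ℝ)) => coordScale i w.1 w.2 := by
  unfold coordScale; fun_prop

theorem contDiff_coordScale_right (i : Fin n) (u : ℝ) :
    ContDiff ℝ ∞ fun q : (Fin n → ℝ) × (Fin m → ℝ) => coordScale i u q := by
  unfold coordScale; fun_prop

theorem hasFDerivAt_coordScale (i : Fin n) (u : ℝ) (q : (Fin n → ℝ) × (Fin m → ℝ)) :
    HasFDerivAt (fun q : (Fin n → ℝ) × (Fin m → ℝ) => coordScale i u q)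
      (ContinuousLinearMap.id ℝ _ + ((u - 1) • ((ContinuousLinearMap.proj i).comp
        (ContinuousLinearMap.fst ℝ (Fin n → ℝ) (Fin m → ℝ)))).smulRight (firstBasis m i)) q :=
  (ContinuousLinearMap.hasFDerivAt (ContinuousLinearMap.id ℝ _ +
    ((u - 1) • ((ContinuousLinearMap.proj i).comp
    (ContinuousLinearMap.fst ℝ (Fin n → ℝ) (Fin m → ℝ)))).smulRight (firstBasis m i)))

theorem dense_coord_ne_zero (i : Fin n) :
    Dense {q : (Fin n → ℝ) × (Fin m → ℝ) | q.1 i ≠ 0} :=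
  (dense_compl_singleton (0 : ℝ)).preimage
    ((isOpenMap_eval (X := fun _ : Fin n => ℝ) i).comp isOpenMap_fst)

variable {E : Type} [NormedAddCommGroup E] [NormedSpace ℝ E] [CompleteSpace E]

/-- Hadamard's lemma, with parities. -/
theorem exists_contDiff_eq_coord_smul {A : (Fin n → ℝ) × (Fin m → ℝ) → E}
    (hA : ContDiff ℝ ∞ A) (i : Fin n) (hodd : ∀ q, A (coordScale i (-1) q) = -A q) :
    ∃ B : (Fin n → ℝ) × (Fin m → ℝ) → E, ContDiff ℝ ∞ B ∧ (∀ q, A q = q.1 i • B q) ∧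
      (∀ q, B (coordScale i (-1) q) = B q) ∧
      ∀ j, j ≠ i → (∀ q, A (coordScale j (-1) q) = A q) → ∀ q, B (coordScale j (-1) q) = B q := by
  have hA' : ContDiff ℝ ∞ (fderiv ℝ A) := hA.fderiv_right (by simp)
  have hK : ContDiff ℝ ∞ fun w : ℝ × ((Fin n → ℝ) × (Fin m → ℝ)) =>
      fderiv ℝ A (coordScale i w.1 w.2) (firstBasis m i) :=
    (hA'.comp (contDiff_coordScale i)).clm_apply contDiff_const
  have hB : ContDiff ℝ ∞ fun q => ∫ u in (0 : ℝ)..1,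
      fderiv ℝ A (coordScale i u q) (firstBasis m i) :=
    contDiff_infty.2 fun N => contDiff_intervalIntegral_param N hK
  have hAB : ∀ q, A q = q.1 i • ∫ u in (0 : ℝ)..1,
      fderiv ℝ A (coordScale i u q) (firstBasis m i) := by
    intro q
    -- The projection to the hyperplane is fixed by the reflection, so oddness makes `A` vanish
    -- there. Integrating the derivative along the segment from this projection to `q` gives the
    -- factorization.
    have h0 : A (coordScale i 0 q) = 0 := by
      have h1 : coordScale i (-1) (coordScale i 0 q) = coordScale i 0 q := by
        conv_lhs => rw [coordScale, coordScale_fst_self]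
        simp
      have h2 := hodd (coordScale i 0 q)
      rw [h1] at h2
      rw [eq_neg_iff_add_eq_zero, ← two_smul ℝ] at h2
      exact (smul_eq_zero.1 h2).resolve_left two_ne_zero
    have hd : ∀ u : ℝ, HasDerivAt (fun u => A (coordScale i u q))
        (q.1 i • fderiv ℝ A (coordScale i u q) (firstBasis m i)) u := by
      intro u
      have h1 : HasDerivAt (fun u => coordScale i u q) (q.1 i • firstBasis m i) u := by
        have := ((((hasDerivAt_id u).sub_const 1).mul_const (q.1 i)).smul_const
          (firstBasis m i)).const_add q
        simpa [coordScale] using this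
      have := (hA.differentiable (by simp) (coordScale i u q)).hasFDerivAt.comp_hasDerivAt u h1
      simpa [Function.comp_def] using this
    have hint := intervalIntegral.integral_eq_sub_of_hasDerivAt (a := 0) (b := 1)
      (fun u _ => hd u) (Continuous.intervalIntegrable
        (continuous_const.smul (hK.continuous.comp (by fun_prop : Continuous fun u : ℝ => (u, q))))
        _ _)
    rw [h0, sub_zero, coordScale_one, intervalIntegral.integral_smul] at hint
    exact hint.symm
  refine ⟨_, hB, hAB, ?_, ?_⟩
  -- Off the hyperplane the parities of `B` follow by cancelling the coordinate. Density and
  -- continuity extend them.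
  · refine fun q => congrFun (Continuous.ext_on (dense_coord_ne_zero i)
      (hB.continuous.comp (contDiff_coordScale_right i (-1)).continuous) hB.continuous ?_) q
    intro q hq
    have h1 := hAB (coordScale i (-1) q)
    rw [hodd, hAB q, coordScale_fst_self, neg_one_mul, neg_smul, neg_inj] at h1
    exact (smul_right_injective E hq h1).symm
  · intro j hj hev
    refine fun q => congrFun (Continuous.ext_on (dense_coord_ne_zero i)
      (hB.continuous.comp (contDiff_coordScale_right j (-1)).continuous) hB.continuous ?_) q
    intro q hq
    have h1 := hAB (coordScale j (-1) q)
    rw [hev, hAB q, coordScale_fst_ne hj.symm] at h1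
    exact (smul_right_injective E hq h1).symm

end Coordinates

/-! ### Whitney's theorem on even functions, over the sector. -/

section Sector
variable {n m : ℕ}

theorem convex_sector (n m : ℕ) : Convex ℝ (sector n m) := by
  intro p hp q hq a b ha hb _ i
  have := hp i
  have := hq i
  simp only [Prod.fst_add, Prod.smul_fst, Pi.add_apply, Pi.smul_apply, smul_eq_mul]
  positivity

/-- The interior of the sector. -/
def openSector (n m : ℕ) : Set ((Fin n → ℝ) × (Fin m → ℝ)) := {q | ∀ i, 0 < q.1 i}

theorem isOpen_openSector (n m : ℕ) : IsOpen (openSector n m) := by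
  simp only [openSector, ofPred_forall]
  exact isOpen_iInter_of_finite fun i => isOpen_lt continuous_const (by fun_prop)

theorem convex_openSector (n m : ℕ) : Convex ℝ (openSector n m) := by
  intro p hp q hq a b ha hb hab i
  have h1 := hp i
  have h2 := hq i
  simp only [Prod.fst_add, Prod.smul_fst, Pi.add_apply, Pi.smul_apply, smul_eq_mul]
  rcases ha.eq_or_lt with rfl | ha
  · simp_all
  · positivity

theorem isClosed_sector (n m : ℕ) : IsClosed (sector n m) := by
  simp only [sector, ofPred_forall]
  exact isClosed_iInter fun i => isClosed_le continuous_const (by fun_prop)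

theorem openSector_subset_sector (n m : ℕ) : openSector n m ⊆ sector n m :=
  fun _ hq i => (hq i).le

theorem closure_openSector (n m : ℕ) : closure (openSector n m) = sector n m := by
  refine (closure_minimal (openSector_subset_sector n m) (isClosed_sector n m)).antisymm ?_
  intro q hq
  have hc : Continuous fun ε : ℝ => ((fun i => q.1 i + ε, q.2) : (Fin n → ℝ) × (Fin m → ℝ)) := by
    fun_prop
  have ht : Tendsto (fun ε : ℝ => ((fun i => q.1 i + ε, q.2) : (Fin n → ℝ) × (Fin m → ℝ)))
      (𝓝[>] 0) (𝓝 q) := by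
    have := hc.tendsto 0
    simp only [add_zero] at this
    exact this.mono_left nhdsWithin_le_nhds
  refine mem_closure_of_tendsto ht ?_
  filter_upwards [self_mem_nhdsWithin] with ε hε i
  exact add_pos_of_nonneg_of_pos (hq i) hε

theorem nonempty_openSector (n m : ℕ) : (openSector n m).Nonempty :=
  ⟨(1, 0), fun _ => one_pos⟩

theorem uniqueDiffOn_sector (n m : ℕ) : UniqueDiffOn ℝ (sector n m) :=
  uniqueDiffOn_convex (convex_sector n m) ((nonempty_openSector n m).mono
    (interior_maximal (openSector_subset_sector n m) (isOpen_openSector n m)))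

theorem continuous_sqrtMap : Continuous (sqrtMap : (Fin n → ℝ) × (Fin m → ℝ) → _) := by
  unfold sqrtMap; fun_prop

theorem hasFDerivAt_sqrtMap {q : (Fin n → ℝ) × (Fin m → ℝ)} (hq : q ∈ openSector n m) :
    HasFDerivAt sqrtMap
      ((ContinuousLinearMap.pi fun i => (1 / (2 * Real.sqrt (q.1 i))) •
        ((ContinuousLinearMap.proj i).comp
          (ContinuousLinearMap.fst ℝ (Fin n → ℝ) (Fin m → ℝ)))).prod
        (ContinuousLinearMap.snd ℝ (Fin n → ℝ) (Fin m → ℝ))) q := by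
  refine HasFDerivAt.prodMk (hasFDerivAt_pi.2 fun i => ?_) hasFDerivAt_snd
  exact HasFDerivAt.sqrt (((ContinuousLinearMap.proj (R := ℝ) (φ := fun _ : Fin n => ℝ) i).comp
          (ContinuousLinearMap.fst ℝ (Fin n → ℝ) (Fin m → ℝ))).hasFDerivAt) (hq i).ne'

theorem eq_sum_firstBasis (v : (Fin n → ℝ) × (Fin m → ℝ)) :
    v = ∑ i, v.1 i • firstBasis m i + (0, v.2) := by
  have h1 : (∑ i, v.1 i • firstBasis m i : (Fin n → ℝ) × (Fin m → ℝ)) = (v.1, 0) := by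
    refine Prod.ext ?_ ?_
    · rw [Prod.fst_sum]
      conv_rhs => rw [pi_eq_sum_univ' v.1]
      refine Finset.sum_congr rfl fun i _ => ?_
      ext j
      simp [firstBasis, Pi.single_apply, eq_comm]
    · rw [Prod.snd_sum]; simp [firstBasis]
  rw [h1]; simp

variable {E : Type} [NormedAddCommGroup E] [NormedSpace ℝ E]

/-- This is the chain rule for the linear reflection. For `F` even in a coordinate, the partial
derivative in that coordinate becomes odd and the others remain even. -/
theorem fderiv_comp_coordScale {F : (Fin n → ℝ) × (Fin m → ℝ) → E} (hF : Differentiable ℝ F)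
    (i : Fin n) (ε : ℝ) (hev : ∀ q, F (coordScale i (-1) q) = ε • F q)
    (q v : (Fin n → ℝ) × (Fin m → ℝ)) :
    fderiv ℝ F (coordScale i (-1) q) (coordScale i (-1) v) = ε • fderiv ℝ F q v := by
  have h1 := ((hF (coordScale i (-1) q)).hasFDerivAt).comp q (hasFDerivAt_coordScale i (-1) q)
  have h2 := (hF q).hasFDerivAt.const_smul ε
  have h3 : F ∘ (fun q => coordScale i (-1) q) = ε • F := funext hev
  rw [h3] at h1
  have := congrArg (fun L : _ →L[ℝ] E => L v) (h1.unique h2)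
  simpa [coordScale] using this

/-- Whitney's theorem on even functions: a smooth function that is even in each of the first
coordinates is, up to the boundary, a smooth function of their squares. -/
theorem contDiffOn_comp_sqrtMap_nat (N : ℕ) : ∀ {E : Type} [NormedAddCommGroup E] [NormedSpace ℝ E]
    [CompleteSpace E] {F : (Fin n → ℝ) × (Fin m → ℝ) → E}, ContDiff ℝ ∞ F →
    (∀ i q, F (coordScale i (-1) q) = F q) → ContDiffOn ℝ N (F ∘ sqrtMap) (sector n m) := by
  induction N with
  | zero =>
    intro E _ _ _ F hF _
    exact contDiffOn_zero.2 (hF.continuous.comp continuous_sqrtMap).continuousOn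
  | succ N ih =>
    intro E _ _ _ F hF hev
    have hFd : Differentiable ℝ F := hF.differentiable (by simp)
    have hF' : ContDiff ℝ ∞ (fderiv ℝ F) := hF.fderiv_right (by simp)
    have hev' : ∀ i q v, fderiv ℝ F (coordScale i (-1) q) (coordScale i (-1) v) =
        fderiv ℝ F q v := fun i q v => by
      simpa using fderiv_comp_coordScale hFd i 1 (by simpa using hev i) q v
    have hb : ∀ i : Fin n, coordScale i (-1) (firstBasis m i) = -firstBasis m i := fun i => by
      simp only [coordScale, firstBasis, Pi.single_eq_same]; module
    have hb' : ∀ i j : Fin n, j ≠ i → coordScale i (-1) (firstBasis m j) = firstBasis m j :=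
      fun i j h => by simp [coordScale, firstBasis, h.symm]
    have hodd : ∀ (i : Fin n) q, fderiv ℝ F (coordScale i (-1) q) (firstBasis m i) =
        -fderiv ℝ F q (firstBasis m i) := fun i q => by
      have := hev' i q (firstBasis m i)
      rw [hb, map_neg] at this
      rw [← this, neg_neg]
    -- The odd partial derivative is `r_i B_i`, and the factor `r_i = √x_i` cancels the singular
    -- factor `1 / (2√x_i)` of the chain rule.
    choose B hBs hBe hBi hBj using fun i : Fin n =>
      exists_contDiff_eq_coord_smul (hF'.clm_apply (contDiff_const (c := firstBasis m i))) i
        (hodd i)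
    -- After composition with `sqrtMap` this is the derivative of `F ∘ sqrtMap`. It is again smooth
    -- and even, so the induction hypothesis applies to it.
    let D : (Fin n → ℝ) × (Fin m → ℝ) → ((Fin n → ℝ) × (Fin m → ℝ)) →L[ℝ] E := fun q =>
      ∑ i, ((ContinuousLinearMap.proj i).comp
          (ContinuousLinearMap.fst ℝ (Fin n → ℝ) (Fin m → ℝ))).smulRight ((1 / 2 : ℝ) • B i q) +
        (fderiv ℝ F q).comp ((ContinuousLinearMap.inr ℝ (Fin n → ℝ) (Fin m → ℝ)).comp
          (ContinuousLinearMap.snd ℝ (Fin n → ℝ) (Fin m → ℝ)))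
    have hDapp : ∀ q v, D q v = ∑ i, v.1 i • ((1 / 2 : ℝ) • B i q) + fderiv ℝ F q (0, v.2) := by
      intro q v
      simp [D]
    have hD : ContDiff ℝ ∞ D := by
      refine ContDiff.add (ContDiff.sum fun i _ => ?_) (hF'.clm_comp contDiff_const)
      exact contDiff_const.smulRight (contDiff_const.smul (hBs i))
    have hDev : ∀ i q, D (coordScale i (-1) q) = D q := by
      intro i q
      refine ContinuousLinearMap.ext fun v => ?_
      rw [hDapp, hDapp]
      congr 1
      · refine Finset.sum_congr rfl fun j _ => ?_
        by_cases h : j = i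
        · rw [h, hBi]
        · rw [hBj j i (Ne.symm h)]
          intro q
          have := hev' i q (firstBasis m j)
          rwa [hb' i j h] at this
      · have := hev' i q (0, v.2)
        rwa [show coordScale i (-1) ((0, v.2) : (Fin n → ℝ) × (Fin m → ℝ)) = (0, v.2) by
          simp [coordScale]] at this
    have hint : ∀ q ∈ openSector n m, HasFDerivAt (F ∘ sqrtMap) (D (sqrtMap q)) q := by
      intro q hq
      convert! ((hFd (sqrtMap q)).hasFDerivAt).comp q (hasFDerivAt_sqrtMap hq) using 1
      refine ContinuousLinearMap.ext fun v => ?_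
      rw [hDapp, ContinuousLinearMap.comp_apply]
      conv_rhs => rw [eq_sum_firstBasis (ContinuousLinearMap.prod _ _ v)]
      rw [map_add, map_sum]
      congr 1
      refine Finset.sum_congr rfl fun i _ => ?_
      rw [map_smul, hBe]
      have h0 : Real.sqrt (q.1 i) ≠ 0 := (Real.sqrt_pos.2 (hq i)).ne'
      simp only [sqrtMap, smul_smul, ContinuousLinearMap.prod_apply,
        ContinuousLinearMap.coe_pi', smul_apply,
        ContinuousLinearMap.comp_apply, ContinuousLinearMap.proj_apply,
        ContinuousLinearMap.coe_fst', smul_eq_mul]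
      congr 1
      field_simp
    refine (contDiffOn_succ_iff_hasFDerivWithinAt_of_uniqueDiffOn (uniqueDiffOn_sector n m)).2
      ⟨by simp, D ∘ sqrtMap, ih hD hDev, fun q hq => ?_⟩
    -- At boundary points, differentiability within the sector follows because the derivatives at
    -- interior points have a limit.
    rw [← closure_openSector]
    refine hasFDerivWithinAt_closure_of_tendsto_fderiv
      (fun q hq => (hint q hq).differentiableAt.differentiableWithinAt) (convex_openSector n m)
      (isOpen_openSector n m)
      (fun q _ => (hF.continuous.comp continuous_sqrtMap).continuousWithinAt) ?_
    refine Tendsto.congr' ?_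
      ((hD.continuous.comp continuous_sqrtMap).continuousWithinAt (s := openSector n m) (x := q))
    filter_upwards [self_mem_nhdsWithin] with p hp
    exact (hint p hp).fderiv.symm

theorem contDiffOn_comp_sqrtMap [CompleteSpace E] {F : (Fin n → ℝ) × (Fin m → ℝ) → E} (hF : ContDiff ℝ ∞ F)
    (hev : ∀ i q, F (coordScale i (-1) q) = F q) :
    ContDiffOn ℝ ∞ (F ∘ sqrtMap) (sector n m) :=
  contDiffOn_infty.2 fun N => contDiffOn_comp_sqrtMap_nat N hF hev

end Sector

/-! ### Smooth arguments of functions with parities. -/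

section Localization
variable {n m : ℕ}

/-- A set in `ℝ^n × ℝ^m` that is stable under sign changes of the first `n` coordinates. -/
def SignInvariant (D : Set ((Fin n → ℝ) × (Fin m → ℝ))) : Prop :=
  ∀ q q' : (Fin n → ℝ) × (Fin m → ℝ), (∀ i, |q.1 i| = |q'.1 i|) → q.2 = q'.2 → q ∈ D → q' ∈ D

theorem sqrtMap_mem_sector (q : (Fin n → ℝ) × (Fin m → ℝ)) : sqrtMap q ∈ sector n m :=
  fun _ => Real.sqrt_nonneg _

theorem sqrtMap_sq (q : (Fin n → ℝ) × (Fin m → ℝ)) :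
    sqrtMap ((fun i => q.1 i ^ 2, q.2) : (Fin n → ℝ) × (Fin m → ℝ)) = (fun i => |q.1 i|, q.2) := by
  simp [sqrtMap, Real.sqrt_sq_eq_abs]

variable {E : Type} [NormedAddCommGroup E] [NormedSpace ℝ E]

/-- A smooth function near `(√x, y)` with prescribed parities in the coordinates in which `x`
vanishes agrees near that point with a globally smooth function of the same parities that is even
in the other coordinates. -/
theorem exists_contDiff_parity_eventuallyEq {F : (Fin n → ℝ) × (Fin m → ℝ) → E}
    {D : Set ((Fin n → ℝ) × (Fin m → ℝ))} (hD : IsOpen D) (hDs : SignInvariant D)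
    (hF : ContDiffOn ℝ ∞ F D) {q₀ : (Fin n → ℝ) × (Fin m → ℝ)} (hq₀ : q₀ ∈ sector n m)
    (hq₀D : sqrtMap q₀ ∈ D) (ε : Fin n → ℝ) (hε : ∀ i, q₀.1 i ≠ 0 → ε i = 1)
    (hpar : ∀ i, q₀.1 i = 0 → ∀ q ∈ D, F (coordScale i (-1) q) = ε i • F q) :
    ∃ G : (Fin n → ℝ) × (Fin m → ℝ) → E, ContDiff ℝ ∞ G ∧
      (∀ i q, G (coordScale i (-1) q) = ε i • G q) ∧ G =ᶠ[𝓝 (sqrtMap q₀)] F := by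
  classical
  -- Absolute values force evenness in the coordinates that do not vanish at `q₀`, and the cut-off
  -- below keeps these away from zero, where `A` is smooth. A cut-off composed with the squares `S`
  -- is even in every coordinate and so leaves the parities intact.
  let A : (Fin n → ℝ) × (Fin m → ℝ) → (Fin n → ℝ) × (Fin m → ℝ) := fun q =>
    (fun i => if q₀.1 i = 0 then q.1 i else |q.1 i|, q.2)
  let S : (Fin n → ℝ) × (Fin m → ℝ) → (Fin n → ℝ) × (Fin m → ℝ) := fun q =>
    (fun i => q.1 i ^ 2, q.2)
  have hS : ContDiff ℝ ∞ S := by fun_prop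
  have hAabs : ∀ q i, |(A q).1 i| = |q.1 i| := by
    intro q i
    simp only [A]
    split_ifs <;> simp
  -- the open set on which the cut-off is supported
  let D' := D ∩ {p | ∀ i, q₀.1 i ≠ 0 → p.1 i ≠ 0}
  have hD' : IsOpen D' := by
    refine hD.inter ?_
    simp only [ofPred_forall]
    exact isOpen_iInter_of_finite fun i => isOpen_iInter_of_finite fun _ =>
      isOpen_ne_fun (by fun_prop) continuous_const
  have hq₀D' : sqrtMap q₀ ∈ D' :=
    ⟨hq₀D, fun i hi => (Real.sqrt_pos.2 ((hq₀ i).lt_of_ne' hi)).ne'⟩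
  obtain ⟨r, hr, hrD⟩ := Metric.nhds_basis_closedBall.mem_iff.1
    ((hD'.preimage continuous_sqrtMap).mem_nhds hq₀D')
  let b : ContDiffBump q₀ := ⟨r / 2, r, by linarith, by linarith⟩
  have hSD : ∀ q, S q ∈ Metric.closedBall q₀ r → A q ∈ D ∧ ∀ i, q₀.1 i ≠ 0 → q.1 i ≠ 0 := by
    intro q hq
    have h1 := hrD hq
    have h2 : sqrtMap (S q) = (fun i => |q.1 i|, q.2) := sqrtMap_sq q
    rw [mem_preimage, h2] at h1
    refine ⟨hDs (fun i => |q.1 i|, q.2) (A q) (fun i => ?_) rfl h1.1,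
      fun i hi => by simpa using h1.2 i hi⟩
    rw [hAabs, abs_abs]
  have hzero : ∀ q, A q ∉ D → b (S q) = 0 := by
    intro q hq
    refine b.zero_of_le_dist ?_
    by_contra! h
    exact hq (hSD q (Metric.mem_closedBall.2 h.le)).1
  have hSsqrt : S (sqrtMap q₀) = q₀ := by
    refine Prod.ext (funext fun i => ?_) rfl
    exact Real.sq_sqrt (hq₀ i)
  refine ⟨fun q => b (S q) • F (A q), contDiff_iff_contDiffAt.2 fun q => ?_, fun i q => ?_, ?_⟩
  · by_cases hq : S q ∈ Metric.closedBall q₀ r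
    · obtain ⟨h1, h2⟩ := hSD q hq
      refine ContDiffAt.smul (b.contDiff.contDiffAt.comp q hS.contDiffAt) ?_
      refine ((hF.contDiffAt (hD.mem_nhds h1)).comp q ?_)
      refine ContDiffAt.prodMk (contDiffAt_pi.2 fun i => ?_) contDiffAt_snd
      by_cases h : q₀.1 i = 0
      · simp only [h, if_true]; fun_prop
      · simp only [h, if_false]
        exact ContDiffAt.comp q (g := fun x : ℝ => |x|) (contDiffAt_abs (h2 i h))
          (by fun_prop : ContDiffAt ℝ ∞ (fun q : (Fin n → ℝ) × (Fin m → ℝ) => q.1 i) q)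
    · have : (fun q => b (S q) • F (A q)) =ᶠ[𝓝 q] fun _ => 0 := by
        filter_upwards [(Metric.isClosed_closedBall.isOpen_compl.preimage hS.continuous).mem_nhds hq]
          with p hp
        rw [b.zero_of_le_dist (not_le.1 (fun h => hp (Metric.mem_closedBall.2 h))).le, zero_smul]
      exact contDiffAt_const.congr_of_eventuallyEq this
  · have h1 : S (coordScale i (-1) q) = S q := by
      refine Prod.ext (funext fun j => ?_) (coordScale_snd _ _ _)
      by_cases h : j = i
      · simp only [S, h, coordScale_fst_self]; ring
      · simp only [S, coordScale_fst_ne h]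
    simp only [h1]
    by_cases h : q₀.1 i = 0
    · have h2 : A (coordScale i (-1) q) = coordScale i (-1) (A q) := by
        refine Prod.ext (funext fun j => ?_) (by simp only [A, coordScale_snd])
        by_cases hj : j = i
        · subst hj
          simp only [A, coordScale_fst_self, h, if_true]
        · simp only [A, coordScale_fst_ne hj]
      by_cases hq : A q ∈ D
      · rw [h2, hpar i h _ hq, smul_comm]
      · rw [hzero q hq, zero_smul, zero_smul, smul_zero]
    · have h2 : A (coordScale i (-1) q) = A q := by
        refine Prod.ext (funext fun j => ?_) (by simp only [A, coordScale_snd])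
        by_cases hj : j = i
        · subst hj
          simp only [A, coordScale_fst_self, h, if_false]
          simp
        · simp only [A, coordScale_fst_ne hj]
      rw [h2, hε i h, one_smul]
  · have h1 : ∀ᶠ q in 𝓝 (sqrtMap q₀), b (S q) = 1 := by
      have : Tendsto S (𝓝 (sqrtMap q₀)) (𝓝 q₀) := by
        conv_rhs => rw [← hSsqrt]
        exact hS.continuous.tendsto _
      exact this.eventually b.eventuallyEq_one
    have h2 : ∀ᶠ q : (Fin n → ℝ) × (Fin m → ℝ) in 𝓝 (sqrtMap q₀),
        ∀ i, q₀.1 i ≠ 0 → 0 < q.1 i := by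
      refine eventually_all.2 fun i => ?_
      by_cases h : q₀.1 i = 0
      · simp [h]
      · have hc : Continuous fun q : (Fin n → ℝ) × (Fin m → ℝ) => q.1 i := by fun_prop
        filter_upwards [hc.continuousAt.eventually (lt_mem_nhds
          (Real.sqrt_pos.2 ((hq₀ i).lt_of_ne' h)))] with q hq _ using hq
    filter_upwards [h1, h2] with q hq1 hq2
    have h3 : A q = q := by
      refine Prod.ext (funext fun i => ?_) rfl
      by_cases h : q₀.1 i = 0
      · simp only [A, h, if_true]
      · simp only [A, h, if_false, abs_of_pos (hq2 i h)]
    rw [hq1, one_smul, h3]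

/-- A nowhere vanishing smooth function on the sector locally has a smooth argument. -/
theorem exists_contDiffOn_arg {g : (Fin n → ℝ) × (Fin m → ℝ) → ℂ}
    (hg : ContDiffOn ℝ ∞ g (sector n m)) {q₀ : (Fin n → ℝ) × (Fin m → ℝ)}
    (hq₀ : q₀ ∈ sector n m) (h0 : g q₀ ≠ 0) :
    ∃ (V : Set ((Fin n → ℝ) × (Fin m → ℝ))) (θ : (Fin n → ℝ) × (Fin m → ℝ) → ℝ), IsOpen V ∧
      q₀ ∈ V ∧ ContDiffOn ℝ ∞ θ (V ∩ sector n m) ∧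
      ∀ q ∈ V ∩ sector n m, g q = ‖g q‖ * Complex.exp (θ q * Complex.I) := by
  have hc : ContinuousWithinAt (fun q => g q / g q₀) (sector n m) q₀ :=
    (hg.continuousOn q₀ hq₀).div_const _
  have h1 : Complex.slitPlane ∈ 𝓝 (g q₀ / g q₀) := by
    rw [div_self h0]
    exact Complex.isOpen_slitPlane.mem_nhds Complex.one_mem_slitPlane
  obtain ⟨V, hV, hqV, hVs⟩ := mem_nhdsWithin.1 (hc h1)
  -- Division by `g q₀` moves the value at `q₀` to `1`, near which the principal logarithm is
  -- smooth.
  refine ⟨V, fun q => (Complex.log (g q / g q₀)).im + (g q₀).arg, hV, hqV, ?_, ?_⟩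
  · refine ContDiffOn.add ?_ contDiffOn_const
    have h2 : ContDiffOn ℝ ∞ (fun q => Complex.log (g q / g q₀)) (V ∩ sector n m) := by
      intro q hq
      have h3 : ContDiffAt ℝ ∞ Complex.log (g q / g q₀) :=
        (Complex.contDiffAt_log (hVs hq)).restrict_scalars ℝ
      exact h3.comp_contDiffWithinAt q (((hg q hq.2).mono inter_subset_right).div_const _)
    exact Complex.imCLM.contDiff.comp_contDiffOn h2
  · intro q hq
    have h3 : g q / g q₀ ≠ 0 := Complex.slitPlane_ne_zero (hVs hq)
    have h4 : g q = (g q / g q₀) * g q₀ := by field_simp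
    have h6 := Complex.norm_mul_exp_arg_mul_I (g q / g q₀)
    have h7 := Complex.norm_mul_exp_arg_mul_I (g q₀)
    simp only [Complex.log_im]
    push_cast
    rw [add_mul, Complex.exp_add]
    have h5 : (‖g q‖ : ℂ) = ‖g q / g q₀‖ * ‖g q₀‖ := by
      rw [← Complex.ofReal_mul, ← norm_mul, ← h4]
    rw [h5]
    conv_lhs => rw [h4, ← h6]
    conv_lhs => enter [2]; rw [← h7]
    ring

/-- The argument of a function with parities, in the square coordinates. -/
theorem exists_contDiffOn_arg_comp_sqrtMap {F : (Fin n → ℝ) × (Fin m → ℝ) → ℂ}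
    {D : Set ((Fin n → ℝ) × (Fin m → ℝ))} (hD : IsOpen D) (hDs : SignInvariant D)
    (hF : ContDiffOn ℝ ∞ F D) {q₀ : (Fin n → ℝ) × (Fin m → ℝ)} (hq₀ : q₀ ∈ sector n m)
    (hq₀D : sqrtMap q₀ ∈ D)
    (h : (F (sqrtMap q₀) ≠ 0 ∧ ∀ i, q₀.1 i = 0 → ∀ q ∈ D, F (coordScale i (-1) q) = F q) ∨
      ∃ i, q₀.1 i = 0 ∧ (∀ q ∈ D, F (coordScale i (-1) q) = -F q) ∧
        (∀ j, j ≠ i → q₀.1 j = 0 → ∀ q ∈ D, F (coordScale j (-1) q) = F q) ∧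
        fderiv ℝ F (sqrtMap q₀) (firstBasis m i) ≠ 0) :
    ∃ (V : Set ((Fin n → ℝ) × (Fin m → ℝ))) (θ : (Fin n → ℝ) × (Fin m → ℝ) → ℝ), IsOpen V ∧
      q₀ ∈ V ∧ ContDiffOn ℝ ∞ θ (V ∩ sector n m) ∧ ∀ q ∈ V ∩ sector n m,
        F (sqrtMap q) = ‖F (sqrtMap q)‖ * Complex.exp (θ q * Complex.I) := by
  classical
  rcases h with ⟨h0, hev⟩ | ⟨i, hi, hodd, hev, hne⟩
  · obtain ⟨G, hG, hGp, hGF⟩ := exists_contDiff_parity_eventuallyEq hD hDs hF hq₀ hq₀D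
      (fun _ => 1) (fun _ _ => rfl) (by simpa using hev)
    obtain ⟨V, θ, hV, hqV, hθ, hVθ⟩ := exists_contDiffOn_arg
      (contDiffOn_comp_sqrtMap hG (by simpa using hGp)) hq₀ (by
        rw [Function.comp_apply, hGF.eq_of_nhds]; exact h0)
    obtain ⟨W, hWF, hW, hqW⟩ := eventually_nhds_iff.1
      (continuous_sqrtMap.continuousAt.eventually hGF)
    refine ⟨V ∩ W, θ, hV.inter hW, ⟨hqV, hqW⟩, hθ.mono (by gcongr; exact inter_subset_left), ?_⟩
    intro q hq
    rw [← hWF q hq.1.2]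
    exact hVθ q ⟨hq.1.1, hq.2⟩
  · obtain ⟨G, hG, hGp, hGF⟩ := exists_contDiff_parity_eventuallyEq hD hDs hF hq₀ hq₀D
      (fun j => if j = i then -1 else 1) (fun j hj => by
        rw [if_neg]; rintro rfl; exact hj hi) (fun j hj q hq => by
        by_cases h : j = i
        · subst h; simpa using hodd q hq
        · simpa [h] using hev j h hj q hq)
    obtain ⟨B, hB, hGB, hBi, hBj⟩ := exists_contDiff_eq_coord_smul hG i
      (fun q => by simpa using hGp i q)
    have hBe : ∀ j q, B (coordScale j (-1) q) = B q := by
      intro j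
      by_cases h : j = i
      · rw [h]; exact hBi
      · exact hBj j h fun q => by simpa [h] using hGp j q
    have hs0 : (sqrtMap q₀).1 i = 0 := by simp [sqrtMap, hi]
    -- Since the `i`-th coordinate vanishes at this point, the value of `B` is the `i`-th partial
    -- derivative of `G`, hence of `F`.
    have hB0 : B (sqrtMap q₀) ≠ 0 := by
      intro h0
      apply hne
      rw [← hGF.fderiv_eq]
      have h1 : G = fun q => q.1 i • B q := funext hGB
      have h2 : HasFDerivAt (fun q : (Fin n → ℝ) × (Fin m → ℝ) => q.1 i)
          ((ContinuousLinearMap.proj i).comp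
          (ContinuousLinearMap.fst ℝ (Fin n → ℝ) (Fin m → ℝ))) (sqrtMap q₀) :=
        ((ContinuousLinearMap.proj (R := ℝ) (φ := fun _ : Fin n => ℝ) i).comp
          (ContinuousLinearMap.fst ℝ (Fin n → ℝ) (Fin m → ℝ))).hasFDerivAt
      have h3 : HasFDerivAt (fun q : (Fin n → ℝ) × (Fin m → ℝ) => q.1 i • B q) _ _ :=
        h2.smul (hB.differentiable (by simp) (sqrtMap q₀)).hasFDerivAt
      rw [h1, HasFDerivAt.fderiv h3]
      simp [h0, hs0]
    obtain ⟨V, θ, hV, hqV, hθ, hVθ⟩ := exists_contDiffOn_arg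
      (contDiffOn_comp_sqrtMap hB hBe) hq₀ hB0
    obtain ⟨W, hWF, hW, hqW⟩ := eventually_nhds_iff.1
      (continuous_sqrtMap.continuousAt.eventually hGF)
    refine ⟨V ∩ W, θ, hV.inter hW, ⟨hqV, hqW⟩, hθ.mono (by gcongr; exact inter_subset_left), ?_⟩
    intro q hq
    have h1 := hVθ q ⟨hq.1.1, hq.2⟩
    -- The factor `√x_i` is a nonnegative real, so an argument of `B` is also an argument of `F`.
    rw [← hWF q hq.1.2, hGB, norm_smul, Real.norm_of_nonneg (sqrtMap_mem_sector q i),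
      Complex.real_smul, Complex.ofReal_mul, mul_assoc]
    exact congrArg _ h1

/-- A smooth function that is even in the coordinates vanishing at the point is smooth in the square
coordinates. -/
theorem contDiffWithinAt_comp_sqrtMap [CompleteSpace E] {F : (Fin n → ℝ) × (Fin m → ℝ) → E}
    {D : Set ((Fin n → ℝ) × (Fin m → ℝ))} (hD : IsOpen D) (hDs : SignInvariant D)
    (hF : ContDiffOn ℝ ∞ F D) {q₀ : (Fin n → ℝ) × (Fin m → ℝ)} (hq₀ : q₀ ∈ sector n m)
    (hq₀D : sqrtMap q₀ ∈ D)
    (hev : ∀ i, ∀ q ∈ D, F (coordScale i (-1) q) = F q) :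
    ContDiffWithinAt ℝ ∞ (F ∘ sqrtMap) (sector n m) q₀ := by
  obtain ⟨G, hG, hGp, hGF⟩ := exists_contDiff_parity_eventuallyEq hD hDs hF hq₀ hq₀D
      (fun _ => 1) (fun _ _ => rfl) (by simpa using fun i _ => hev i)
  refine (contDiffOn_comp_sqrtMap hG (by simpa using hGp) q₀ hq₀).congr_of_eventuallyEq ?_
    hGF.symm.eq_of_nhds
  exact (continuous_sqrtMap.continuousAt.eventually hGF.symm).filter_mono nhdsWithin_le_nhds

end Localization

/-! ### The torus: smooth structure, exponential map and lifts. -/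

theorem contMDiff_torus_apply {k : ℕ} (j : Fin k) :
    ContMDiff (torusModel k) (𝓡 1) ∞ fun t : Torus k => t j := by
  intro t
  refine contMDiffAt_iff.2 ⟨(continuous_apply j).continuousAt, ?_⟩
  have h1 := (contMDiffAt_iff.1 (contMDiffAt_id (I := 𝓡 1) (n := ∞) (x := t j))).2
  have h2 : ContDiffWithinAt ℝ ∞ (fun v : Fin k → EuclideanSpace ℝ (Fin 1) => v j)
      (range (torusModel k)) (extChartAt (torusModel k) t t) :=
    contDiffWithinAt_pi.1 contDiffWithinAt_id j
  refine ContDiffWithinAt.comp (extChartAt (torusModel k) t t)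
    (g := (extChartAt (𝓡 1) (t j) ∘ id ∘ (extChartAt (𝓡 1) (t j)).symm))
    (t := range (𝓡 1)) h1 h2 ?_
  rintro _ ⟨w, rfl⟩
  exact mem_range_self (w j)

theorem contMDiffOn_torus_of_apply {k : ℕ} {E : Type*} [NormedAddCommGroup E] [NormedSpace ℝ E]
    {f : E → Torus k} {s : Set E}
    (hf : ∀ j, ContMDiffOn 𝓘(ℝ, E) (𝓡 1) ∞ (fun x => f x j) s) :
    ContMDiffOn 𝓘(ℝ, E) (torusModel k) ∞ f s := by
  intro x hx
  refine contMDiffWithinAt_iff.2 ⟨continuousWithinAt_pi.2 fun j =>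
    (hf j x hx).continuousWithinAt, ?_⟩
  refine contDiffWithinAt_pi.2 fun j => ?_
  exact (contMDiffWithinAt_iff.1 (hf j x hx)).2

/-- The exponential map of the torus. -/
def torusExp {k : ℕ} (v : Fin k → ℝ) : Torus k := fun j => Circle.exp (v j)

theorem torusExp_add {k : ℕ} (v w : Fin k → ℝ) : torusExp (v + w) = torusExp v * torusExp w :=
  funext fun j => Circle.exp_add (v j) (w j)

theorem torusExp_neg {k : ℕ} (v : Fin k → ℝ) : torusExp (-v) = (torusExp v)⁻¹ :=
  funext fun j => Circle.exp_neg (v j)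

theorem continuous_torusExp {k : ℕ} : Continuous (torusExp : (Fin k → ℝ) → Torus k) :=
  continuous_pi fun j => Circle.exp.continuous.comp (continuous_apply j)

theorem ContDiffOn.contMDiffOn_torusExp {k : ℕ} {E : Type*} [NormedAddCommGroup E]
    [NormedSpace ℝ E] {f : E → Fin k → ℝ} {s : Set E} (hf : ContDiffOn ℝ ∞ f s) :
    ContMDiffOn 𝓘(ℝ, E) (torusModel k) ∞ (fun x => torusExp (f x)) s :=
  contMDiffOn_torus_of_apply fun j =>
    contMDiff_circleExp.comp_contMDiffOn ((contDiffOn_pi.1 hf j).contMDiffOn)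

theorem contMDiff_circle_coe : ContMDiff (𝓡 1) 𝓘(ℝ, ℂ) ∞ fun z : Circle => (z : ℂ) :=
  letI := finrank_real_complex_fact'
  contMDiff_coe_sphere

/-- A convex set is simply connected, so a continuous logarithm exists. Its real part vanishes
because the modulus is one. -/
theorem exists_continuousOn_circle_lift {X : Type*} [NormedAddCommGroup X] [NormedSpace ℝ X]
    {U : Set X} (hU : IsOpen U) (hc : Convex ℝ U) (hne : U.Nonempty) {f : X → Circle}
    (hf : ContinuousOn f U) :
    ∃ θ : X → ℝ, ContinuousOn θ U ∧ ∀ x ∈ U, f x = Circle.exp (θ x) := by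
  have hU' : IsSimplyConnected U := by
    have := hc.contractibleSpace hne
    exact (inferInstance : SimplyConnectedSpace U)
  obtain ⟨g, hg, hgf⟩ := Complex.exists_continuousOn_eqOn_exp_comp hU' hU
    (g := fun x => (f x : ℂ)) (continuous_subtype_val.comp_continuousOn hf) (by
      rintro ⟨x, _, hx⟩; exact (f x).coe_ne_zero hx)
  refine ⟨fun x => (g x).im, Complex.continuous_im.comp_continuousOn hg, fun x hx => ?_⟩
  have h1 : Complex.exp (g x) = f x := hgf hx
  have h2 : (g x).re = 0 := by
    have := congrArg norm h1
    rw [Complex.norm_exp, Circle.norm_coe] at this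
    exact Real.exp_eq_one_iff _ |>.1 this
  apply Circle.ext
  rw [Circle.coe_exp, ← h1]
  congr 1
  apply Complex.ext <;> simp [h2]

theorem exists_continuousOn_torus_lift {k : ℕ} {X : Type*} [NormedAddCommGroup X] [NormedSpace ℝ X]
    {U : Set X} (hU : IsOpen U) (hc : Convex ℝ U) (hne : U.Nonempty) {f : X → Torus k}
    (hf : ContinuousOn f U) :
    ∃ θ : X → Fin k → ℝ, ContinuousOn θ U ∧ ∀ x ∈ U, f x = torusExp (θ x) := by
  choose θ hθ hfθ using fun j => exists_continuousOn_circle_lift hU hc hne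
    ((continuous_apply j).comp_continuousOn hf)
  exact ⟨fun x j => θ j x, continuousOn_pi.2 hθ, fun x hx => funext fun j => hfθ j x hx⟩

/-- A continuous function whose exponential is trivial is constant on preconnected sets. -/
theorem constant_of_torusExp_eq_one {k : ℕ} {X : Type*} [TopologicalSpace X] {S : Set X}
    (hS : IsPreconnected S) {f : X → Fin k → ℝ} (hf : ContinuousOn f S)
    (h1 : ∀ x ∈ S, torusExp (f x) = 1) {x y : X} (hx : x ∈ S) (hy : y ∈ S) : f x = f y := by
  funext j
  have hpi : (2 * Real.pi) ≠ 0 := by positivity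
  have hT : ∀ x ∈ S, ∃ n : ℤ, f x j / (2 * Real.pi) = n := fun x hx => by
    obtain ⟨n, hn⟩ := Circle.exp_eq_one.1 (congrFun (h1 x hx) j)
    exact ⟨n, by rw [hn]; field_simp⟩
  have hc : ContinuousOn (fun x => f x j / (2 * Real.pi)) S :=
    ((continuous_apply j).comp_continuousOn hf).div_const _
  have hp := hS.image _ hc
  have hsub : (fun x => f x j / (2 * Real.pi)) '' S ⊆ range ((↑) : ℤ → ℝ) := by
    rintro _ ⟨x, hx, rfl⟩
    obtain ⟨n, hn⟩ := hT x hx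
    exact ⟨n, hn.symm⟩
  have hsing : ((fun x => f x j / (2 * Real.pi)) '' S).Subsingleton :=
    ((countable_range _).mono hsub).isTotallyDisconnected _ subset_rfl hp
  have := hsing (mem_image_of_mem _ hx) (mem_image_of_mem _ hy)
  simpa [div_left_inj' hpi] using this

/-- Continuous homomorphisms from a vector space to the torus are exponentials of linear maps. -/
theorem exists_linear_lift {k : ℕ} {X : Type*} [NormedAddCommGroup X] [NormedSpace ℝ X]
    {χ : X → Torus k} (hχ : Continuous χ) (hadd : ∀ x y, χ (x + y) = χ x * χ y) :
    ∃ L : X →L[ℝ] (Fin k → ℝ), ∀ x, χ x = torusExp (L x) := by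
  obtain ⟨θ, hθ, hχθ⟩ := exists_continuousOn_torus_lift isOpen_univ convex_univ univ_nonempty
    hχ.continuousOn
  have hθ' : Continuous θ := continuousOn_univ.1 hθ
  have h0 : χ 0 = 1 := by simpa using hadd 0 0
  let g : X → Fin k → ℝ := fun x => θ x - θ 0
  have hg : ∀ x, χ x = torusExp (g x) := fun x => by
    rw [show g x = θ x + -θ 0 from sub_eq_add_neg _ _, torusExp_add, torusExp_neg,
      ← hχθ x trivial, ← hχθ 0 trivial, h0, inv_one, mul_one]
  have hgadd : ∀ x y, g (x + y) = g x + g y := fun x y => by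
    -- The defect of additivity has trivial exponential, so it is constant on `X × X`. It vanishes
    -- at the origin.
    have := constant_of_torusExp_eq_one (S := (univ : Set (X × X))) isPreconnected_univ
      (f := fun p => g (p.1 + p.2) + -(g p.1 + g p.2)) (by fun_prop) (fun p _ => by
        rw [torusExp_add, torusExp_neg, torusExp_add, ← hg, ← hg, ← hg, hadd, mul_inv_cancel])
      (mem_univ (x, y)) (mem_univ (0, 0))
    have hg0 : g 0 = 0 := sub_self _
    simp only [add_zero, hg0, neg_zero] at this
    rwa [add_neg_eq_zero] at this
  exact ⟨AddMonoidHom.toRealLinearMap ⟨⟨g, sub_self _⟩, hgadd⟩ (hθ'.sub continuous_const), hg⟩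

/-! ### Equivariant functions on `ℂ^n × ℝ^m` and their parities at real points. -/

section Equivariant
variable {n m : ℕ}

/-- The rotation of the complex coordinates by an element of the torus. -/
def rotate (t : Torus n) :
    ((Fin n → ℂ) × (Fin m → ℝ)) →L[ℝ] ((Fin n → ℂ) × (Fin m → ℝ)) :=
  (ContinuousLinearMap.pi fun i => (ContinuousLinearMap.mul ℝ ℂ (t i : ℂ)).comp
    ((ContinuousLinearMap.proj i).comp
      (ContinuousLinearMap.fst ℝ (Fin n → ℂ) (Fin m → ℝ)))).prod
    (ContinuousLinearMap.snd ℝ (Fin n → ℂ) (Fin m → ℝ))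

theorem rotate_apply (t : Torus n) (p : (Fin n → ℂ) × (Fin m → ℝ)) :
    rotate t p = (fun i => (t i : ℂ) * p.1 i, p.2) := rfl

/-- The inclusion `ℝ^n × ℝ^m ⊆ ℂ^n × ℝ^m`. -/
def realIncl : ((Fin n → ℝ) × (Fin m → ℝ)) →L[ℝ] ((Fin n → ℂ) × (Fin m → ℝ)) :=
  (ContinuousLinearMap.pi fun i => Complex.ofRealCLM.comp
    ((ContinuousLinearMap.proj i).comp
      (ContinuousLinearMap.fst ℝ (Fin n → ℝ) (Fin m → ℝ)))).prod
    (ContinuousLinearMap.snd ℝ (Fin n → ℝ) (Fin m → ℝ))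

theorem realIncl_apply (p : (Fin n → ℝ) × (Fin m → ℝ)) :
    realIncl p = (fun i => (p.1 i : ℂ), p.2) := rfl

/-- The element of the torus with `-1` at the place `i`. -/
def signAt (i : Fin n) : Torus n := Function.update 1 i (-1)

theorem signAt_self (i : Fin n) : ((signAt i i : Circle) : ℂ) = -1 := by
  simp [signAt]

theorem signAt_ne {i j : Fin n} (h : j ≠ i) : signAt i j = 1 := by
  simp [signAt, h]

theorem realIncl_coordScale (i : Fin n) (q : (Fin n → ℝ) × (Fin m → ℝ)) :
    realIncl (coordScale i (-1) q) = rotate (signAt i) (realIncl q) := by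
  refine Prod.ext (funext fun j => ?_) (coordScale_snd _ _ _)
  simp only [realIncl_apply, rotate_apply]
  by_cases h : j = i
  · subst h; rw [coordScale_fst_self, signAt_self]; simp
  · rw [coordScale_fst_ne h, signAt_ne h]; simp

theorem signInvariant_preimage_realIncl {D : Set ((Fin n → ℂ) × (Fin m → ℝ))}
    (hD : ∀ t, ∀ p ∈ D, rotate t p ∈ D) : SignInvariant (realIncl ⁻¹' D) := by
  intro q q' h1 h2 hq
  let t : Torus n := fun i => if q.1 i = q'.1 i then 1 else -1
  have : realIncl q' = rotate t (realIncl q) := by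
    refine Prod.ext (funext fun j => ?_) h2.symm
    simp only [realIncl_apply, rotate_apply, t]
    split_ifs with h
    · rw [h]; simp
    · rw [(abs_eq_abs.1 (h1 j)).resolve_left h]; simp
  rw [mem_preimage, this]
  exact hD t _ hq

/-- Sign changes in vanishing coordinates fix the point. If `F` is nonzero there, they must act on
`F` trivially, which is evenness. Otherwise the differential at the point transforms by `χ` under
the stabilizer. It is nonzero in some direction `z_i` with `x_i = 0`, and comparing the effect of
sign changes on that direction makes `F` odd in `r_i` and even in the other vanishing coordinates.
-/
theorem exists_contDiffOn_arg_of_equivariant {F : (Fin n → ℂ) × (Fin m → ℝ) → ℂ}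
    {D : Set ((Fin n → ℂ) × (Fin m → ℝ))} (hD : IsOpen D) (hDt : ∀ t, ∀ p ∈ D, rotate t p ∈ D)
    (hF : ContDiffOn ℝ ∞ F D) (χ : Torus n → ℂ) (hχ : ∀ t, ∀ p ∈ D, F (rotate t p) = χ t * F p)
    {q₀ : (Fin n → ℝ) × (Fin m → ℝ)} (hq₀ : q₀ ∈ sector n m) (hq₀D : realIncl (sqrtMap q₀) ∈ D)
    (h : F (realIncl (sqrtMap q₀)) ≠ 0 ∨ (fderiv ℝ F (realIncl (sqrtMap q₀)) ≠ 0 ∧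
      ∃ t : Torus n, (∀ i, q₀.1 i ≠ 0 → t i = 1) ∧ χ t = -1)) :
    ∃ (V : Set ((Fin n → ℝ) × (Fin m → ℝ))) (θ : (Fin n → ℝ) × (Fin m → ℝ) → ℝ), IsOpen V ∧
      q₀ ∈ V ∧ ContDiffOn ℝ ∞ θ (V ∩ sector n m) ∧ ∀ q ∈ V ∩ sector n m,
        F (realIncl (sqrtMap q)) =
          ‖F (realIncl (sqrtMap q))‖ * Complex.exp (θ q * Complex.I) := by
  classical
  set p₀ := realIncl (sqrtMap q₀) with hp₀
  have hfix : ∀ t : Torus n, (∀ i, q₀.1 i ≠ 0 → t i = 1) → rotate t p₀ = p₀ := by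
    intro t ht
    refine Prod.ext (funext fun i => ?_) rfl
    rw [rotate_apply]
    by_cases hi : q₀.1 i = 0
    · simp [hp₀, realIncl_apply, sqrtMap, hi]
    · simp [ht i hi]
  have hsfix : ∀ i, q₀.1 i = 0 → ∀ j, q₀.1 j ≠ 0 → signAt i j = 1 := by
    intro i hi j hj
    exact signAt_ne (by rintro rfl; exact hj hi)
  refine exists_contDiffOn_arg_comp_sqrtMap (F := F ∘ realIncl) (hD.preimage realIncl.continuous)
    (signInvariant_preimage_realIncl hDt)
    (hF.comp realIncl.contDiff.contDiffOn fun _ h => h) hq₀ hq₀D ?_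
  have hscale : ∀ i, ∀ q ∈ realIncl ⁻¹' D, (F ∘ realIncl) (coordScale i (-1) q) =
      χ (signAt i) * (F ∘ realIncl) q := by
    intro i q hq
    rw [Function.comp_apply, realIncl_coordScale, hχ _ _ hq, Function.comp_apply]
  by_cases h0 : F p₀ ≠ 0
  · refine Or.inl ⟨h0, fun i hi q hq => ?_⟩
    have h1 := hχ (signAt i) p₀ hq₀D
    rw [hfix _ (hsfix i hi)] at h1
    rw [hscale i q hq, mul_right_cancel₀ h0 ((one_mul _).trans h1).symm, one_mul]
  · obtain ⟨hd, t, ht, hχt⟩ := h.resolve_left h0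
    have hdF : ∀ t : Torus n, (∀ i, q₀.1 i ≠ 0 → t i = 1) → ∀ v,
        fderiv ℝ F p₀ (rotate t v) = χ t * fderiv ℝ F p₀ v := by
      intro t ht v
      have hFd : HasFDerivAt F (fderiv ℝ F p₀) p₀ :=
        ((hF.contDiffAt (hD.mem_nhds hq₀D)).differentiableAt (by simp)).hasFDerivAt
      have h1 : HasFDerivAt (F ∘ rotate t) ((fderiv ℝ F p₀).comp (rotate t)) p₀ := by
        refine HasFDerivAt.comp p₀ ?_ (rotate t).hasFDerivAt
        rw [hfix t ht]; exact hFd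
      have h2 : HasFDerivAt (F ∘ rotate t) (χ t • fderiv ℝ F p₀) p₀ := by
        refine (hFd.const_smul (χ t)).congr_of_eventuallyEq ?_
        filter_upwards [hD.mem_nhds hq₀D] with p hp
        simpa using hχ t p hp
      exact congrArg (fun L : _ →L[ℝ] ℂ => L v) (h1.unique h2)
    have hrs : ∀ (t : Torus n) i (a : ℂ), rotate t ((Pi.single i a, 0) : (Fin n → ℂ) × (Fin m → ℝ))
        = (Pi.single i (t i * a), 0) := by
      intro t i a
      refine Prod.ext (funext fun j => ?_) rfl
      by_cases hj : j = i
      · subst hj; simp [rotate_apply]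
      · simp [rotate_apply, hj]
    have hneg : ∀ x : ℂ, x = -1 * x → x = 0 := fun x hx => by
      rw [neg_one_mul] at hx; exact self_eq_neg.1 hx
    obtain ⟨i, hi, a, ha⟩ : ∃ i, q₀.1 i = 0 ∧ ∃ a : ℂ,
        fderiv ℝ F p₀ (Pi.single i a, 0) ≠ 0 := by
      -- The element `t` fixes all directions except the `z_i` with `x_i = 0`. As `χ t = -1`, the
      -- differential takes on each fixed direction a value equal to its own negative.
      by_contra! hcon
      refine hd (ContinuousLinearMap.ext fun v => ?_)
      have h1 : ∀ i (a : ℂ), fderiv ℝ F p₀ (Pi.single i a, 0) = 0 := by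
        intro i a
        by_cases hi : q₀.1 i = 0
        · exact hcon i hi a
        · apply hneg
          rw [← hχt, ← hdF t ht, hrs, ht i hi, Circle.coe_one, one_mul]
      have h2 : fderiv ℝ F p₀ (0, v.2) = 0 := by
        apply hneg
        rw [← hχt, ← hdF t ht]
        congr 1
        refine Prod.ext (funext fun j => ?_) rfl
        simp [rotate_apply]
      have h3 : v = ∑ i, ((Pi.single i (v.1 i), 0) : (Fin n → ℂ) × (Fin m → ℝ)) + (0, v.2) := by
        refine Prod.ext ?_ ?_
        · rw [Prod.fst_add, Prod.fst_sum]
          simp [Finset.univ_sum_single]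
        · rw [Prod.snd_add, Prod.snd_sum]; simp
      rw [h3, map_add, map_sum, h2]
      simp [h1]
    have hone : fderiv ℝ F p₀ (Pi.single i 1, 0) ≠ 0 := by
      intro h1
      apply ha
      -- This stabilizer element rotates the real direction to the direction of `a`, so vanishing on
      -- one forces vanishing on the other.
      let t' : Torus n := Function.update 1 i (Circle.exp a.arg)
      have h2 := hdF t' (fun j hj => by
        have : j ≠ i := by rintro rfl; exact hj hi
        simp [t', this]) (Pi.single i 1, 0)
      rw [h1, mul_zero, hrs, mul_one] at h2
      have h3 : ((Pi.single i a, 0) : (Fin n → ℂ) × (Fin m → ℝ)) =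
          ‖a‖ • (Pi.single i ((t' i : Circle) : ℂ), 0) := by
        rw [Prod.smul_mk, ← Pi.single_smul, smul_zero]
        simp [t', Complex.norm_mul_exp_arg_mul_I]
      rw [h3, map_smul, h2, smul_zero]
    have hodd : χ (signAt i) = -1 := by
      have h1 := hdF (signAt i) (hsfix i hi) (Pi.single i 1, 0)
      have h2 : ((Pi.single i (-1), 0) : (Fin n → ℂ) × (Fin m → ℝ)) = -(Pi.single i 1, 0) := by
        rw [Pi.single_neg]; simp
      rw [hrs, signAt_self, mul_one, h2, map_neg, ← neg_one_mul] at h1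
      exact (mul_right_cancel₀ hone h1).symm
    have heven : ∀ j, j ≠ i → q₀.1 j = 0 → χ (signAt j) = 1 := by
      intro j hj hj0
      have h1 := hdF (signAt j) (hsfix j hj0) (Pi.single i 1, 0)
      rw [hrs, signAt_ne hj.symm, Circle.coe_one, mul_one] at h1
      exact (mul_right_cancel₀ hone ((one_mul _).trans h1)).symm
    refine Or.inr ⟨i, hi, fun q hq => ?_, fun j hj hj0 q hq => ?_, ?_⟩
    · rw [hscale i q hq, hodd, neg_one_mul]
    · rw [hscale j q hq, heven j hj hj0, one_mul]
    · have hFd : HasFDerivAt F (fderiv ℝ F p₀) p₀ :=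
        ((hF.contDiffAt (hD.mem_nhds hq₀D)).differentiableAt (by simp)).hasFDerivAt
      have h1 : HasFDerivAt (F ∘ realIncl) ((fderiv ℝ F p₀).comp realIncl) (sqrtMap q₀) :=
        HasFDerivAt.comp _ hFd realIncl.hasFDerivAt
      rw [h1.fderiv, ContinuousLinearMap.comp_apply]
      have h2 : realIncl (firstBasis m i) = ((Pi.single i 1, 0) : (Fin n → ℂ) × (Fin m → ℝ)) := by
        refine Prod.ext (funext fun j => ?_) rfl
        by_cases hj : j = i
        · subst hj; simp [realIncl_apply, firstBasis]
        · simp [realIncl_apply, firstBasis, hj]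
      rwa [h2]

end Equivariant

/-! ### Orbit coordinates and slice of the local model. -/

section StandardSpace
variable {n l m : ℕ}

/-- The coordinates of the orbit of a point of the local model. -/
def toCoord (v : StdSpace n l m) : (Fin n → ℝ) × (Fin m → ℝ) := (fun i => ‖v.1 i‖ ^ 2, v.2.2)

/-- The slice `ℂ^n × 1 × ℝ^m` of the local model. -/
def stdSlice (p : (Fin n → ℂ) × (Fin m → ℝ)) : StdSpace n l m := (p.1, (1, p.2))

theorem continuous_toCoord : Continuous (toCoord : StdSpace n l m → _) := by
  unfold toCoord; fun_prop

theorem continuous_stdSection :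
    Continuous (stdSection : _ → StdSpace n l m) := by
  unfold stdSection; fun_prop

theorem toCoord_mem_sector (v : StdSpace n l m) : toCoord v ∈ sector n m :=
  fun _ => by simp only [toCoord]; positivity

theorem toCoord_stdAct (t : Torus n × Torus l) (v : StdSpace n l m) :
    toCoord (stdAct t v) = toCoord v := by
  refine Prod.ext (funext fun i => ?_) rfl
  simp only [toCoord, stdAct, norm_mul, Circle.norm_coe, one_mul]

theorem toCoord_stdSection {q : (Fin n → ℝ) × (Fin m → ℝ)} (hq : q ∈ sector n m) :
    toCoord (stdSection q : StdSpace n l m) = q := by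
  refine Prod.ext (funext fun i => ?_) rfl
  simp [toCoord, stdSection, Real.sq_sqrt (hq i)]

/-- A point of the local model is obtained from the standard section by its arguments. -/
theorem eq_stdAct_stdSection_of_arg (v : StdSpace n l m) (t : Torus n × Torus l)
    (h1 : ∀ i, v.1 i = ‖v.1 i‖ * (t.1 i : ℂ)) (h2 : v.2.1 = t.2) :
    v = stdAct t (stdSection (toCoord v)) := by
  refine Prod.ext (funext fun i => ?_) (Prod.ext ?_ rfl)
  · simp only [stdAct, stdSection, toCoord, Real.sqrt_sq (norm_nonneg _)]
    rw [mul_comm]; exact h1 i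
  · simp [stdAct, stdSection, h2]

theorem exists_eq_stdAct_stdSection (v : StdSpace n l m) :
    ∃ t : Torus n × Torus l, v = stdAct t (stdSection (toCoord v)) := by
  refine ⟨(fun i => Circle.exp (v.1 i).arg, v.2.1), eq_stdAct_stdSection_of_arg _ _ (fun i => ?_)
    rfl⟩
  rw [Circle.coe_exp, Complex.norm_mul_exp_arg_mul_I]

theorem stdAct_stdSlice (t : Torus n) (u : Torus l) (p : (Fin n → ℂ) × (Fin m → ℝ)) :
    stdAct (t, u) (stdSlice p : StdSpace n l m) = ((rotate t p).1, (u, p.2)) := by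
  simp [stdAct, stdSlice, rotate_apply]

theorem contMDiff_stdSlice :
    ContMDiff 𝓘(ℝ, (Fin n → ℂ) × (Fin m → ℝ)) (stdModel n l m) ∞
      (stdSlice : _ → StdSpace n l m) :=
  contDiff_fst.contMDiff.prodMk (contMDiff_const.prodMk contDiff_snd.contMDiff)

end StandardSpace

/-! ### Transitions between standard charts. -/

section Charts

variable {E : Type*} [NormedAddCommGroup E] [NormedSpace ℝ E] {H : Type*} [TopologicalSpace H]
  {I : ModelWithCorners ℝ E H} {k : ℕ} {M : Type*} [TopologicalSpace M] [ChartedSpace H M]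
  [MulAction (Torus k) M]

namespace StandardChart

theorem mem_target (c : StandardChart I k M) (v : StdSpace c.n c.l c.m) : v ∈ c.chart.target := by
  rw [c.target_eq]; trivial

theorem symm_mem_source (c : StandardChart I k M) (v : StdSpace c.n c.l c.m) :
    c.chart.symm v ∈ c.chart.source :=
  c.chart.map_target (c.mem_target v)

theorem chart_symm (c : StandardChart I k M) (v : StdSpace c.n c.l c.m) :
    c.chart (c.chart.symm v) = v :=
  c.chart.right_inv (c.mem_target v)

theorem symm_stdAct (c : StandardChart I k M) (t : Torus k) (v : StdSpace c.n c.l c.m) :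
    c.chart.symm (stdAct (c.split t) v) = t • c.chart.symm v := by
  have h := c.smul_mem_source t _ (c.symm_mem_source v)
  rw [← c.chart.left_inv h, c.map_smul t _ (c.symm_mem_source v), chart_symm]

theorem symm_stdAct' (c : StandardChart I k M) (t : Torus c.n × Torus c.l)
    (v : StdSpace c.n c.l c.m) :
    c.chart.symm (stdAct t v) = c.split.symm t • c.chart.symm v := by
  rw [← c.symm_stdAct, ContinuousMulEquiv.apply_symm_apply]

theorem continuous_symm (c : StandardChart I k M) : Continuous c.chart.symm := by
  have := c.chart.continuousOn_symm
  rwa [c.target_eq, continuousOn_univ] at this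

theorem smul_mem_source_iff (c : StandardChart I k M) (t : Torus k) (x : M) :
    t • x ∈ c.chart.source ↔ x ∈ c.chart.source :=
  ⟨fun h => by simpa using c.smul_mem_source t⁻¹ _ h, c.smul_mem_source t x⟩

/-- The slice of a standard chart. -/
def slice (c : StandardChart I k M) (p : (Fin c.n → ℂ) × (Fin c.m → ℝ)) : M :=
  c.chart.symm (stdSlice p)

theorem slice_rotate (c : StandardChart I k M) (t : Torus c.n)
    (p : (Fin c.n → ℂ) × (Fin c.m → ℝ)) :
    c.slice (rotate t p) = c.split.symm (t, 1) • c.slice p := by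
  rw [slice, slice, ← symm_stdAct', stdAct_stdSlice]; rfl

theorem continuous_slice (c : StandardChart I k M) : Continuous c.slice :=
  c.continuous_symm.comp (contMDiff_stdSlice.continuous)

/-- The part of the slice of a chart that lies in another chart. -/
def sliceOverlap (c c' : StandardChart I k M) : Set ((Fin c.n → ℂ) × (Fin c.m → ℝ)) :=
  c.slice ⁻¹' c'.chart.source

theorem isOpen_sliceOverlap (c c' : StandardChart I k M) : IsOpen (c.sliceOverlap c') :=
  c'.chart.open_source.preimage c.continuous_slice

theorem rotate_mem_sliceOverlap (c c' : StandardChart I k M) (t : Torus c.n)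
    (p : (Fin c.n → ℂ) × (Fin c.m → ℝ)) (hp : p ∈ c.sliceOverlap c') :
    rotate t p ∈ c.sliceOverlap c' := by
  rw [sliceOverlap, mem_preimage, slice_rotate]
  exact c'.smul_mem_source _ _ hp

/-- The expression of the slice of a chart in another chart. -/
def sliceTrans (c c' : StandardChart I k M) (p : (Fin c.n → ℂ) × (Fin c.m → ℝ)) :
    StdSpace c'.n c'.l c'.m :=
  c'.chart (c.slice p)

theorem sliceTrans_rotate (c c' : StandardChart I k M) (t : Torus c.n)
    {p : (Fin c.n → ℂ) × (Fin c.m → ℝ)} (hp : p ∈ c.sliceOverlap c') :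
    c.sliceTrans c' (rotate t p) =
      stdAct (c'.split (c.split.symm (t, 1))) (c.sliceTrans c' p) := by
  rw [sliceTrans, slice_rotate, c'.map_smul _ _ hp]; rfl

theorem contMDiffOn_sliceTrans (c c' : StandardChart I k M) :
    ContMDiffOn 𝓘(ℝ, (Fin c.n → ℂ) × (Fin c.m → ℝ)) (stdModel c'.n c'.l c'.m) ∞
      (c.sliceTrans c') (c.sliceOverlap c') :=
  c'.contMDiffOn_chart.comp (c.contMDiff_symm.comp contMDiff_stdSlice).contMDiffOn fun _ h => h

theorem contDiffOn_sliceTrans_fst (c c' : StandardChart I k M) :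
    ContDiffOn ℝ ∞ (fun p => (c.sliceTrans c' p).1) (c.sliceOverlap c') :=
  (contMDiff_fst.comp_contMDiffOn (c.contMDiffOn_sliceTrans c')).contDiffOn

theorem contDiffOn_sliceTrans_torus (c c' : StandardChart I k M) (j : Fin c'.l) :
    ContDiffOn ℝ ∞ (fun p => (((c.sliceTrans c' p).2.1 j : Circle) : ℂ)) (c.sliceOverlap c') :=
  (contMDiff_circle_coe.comp_contMDiffOn ((contMDiff_torus_apply j).comp_contMDiffOn
    (contMDiff_fst.comp_contMDiffOn
      (contMDiff_snd.comp_contMDiffOn (c.contMDiffOn_sliceTrans c'))))).contDiffOn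

theorem contDiffOn_sliceTrans_snd (c c' : StandardChart I k M) :
    ContDiffOn ℝ ∞ (fun p => (c.sliceTrans c' p).2.2) (c.sliceOverlap c') :=
  (contMDiff_snd.comp_contMDiffOn
      (contMDiff_snd.comp_contMDiffOn (c.contMDiffOn_sliceTrans c'))).contDiffOn

/-- Complex coordinates of a transition of slices have nonzero differential where they vanish. -/
theorem fderiv_sliceTrans_ne_zero (c c' : StandardChart I k M)
    {p : (Fin c.n → ℂ) × (Fin c.m → ℝ)} (hp : p ∈ c.sliceOverlap c') (j : Fin c'.n)
    (h0 : (c.sliceTrans c' p).1 j = 0) :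
    fderiv ℝ (fun p => (c.sliceTrans c' p).1 j) p ≠ 0 := by
  intro hd
  let v := c.sliceTrans c' p
  -- This curve moves only the vanishing coordinate `j` of `c'`, at unit speed.
  let e : ℝ → StdSpace c'.n c'.l c'.m := fun w =>
    (v.1 + Pi.single j (w : ℂ), (v.2.1, v.2.2))
  have he : ContMDiff 𝓘(ℝ, ℝ) (stdModel c'.n c'.l c'.m) ∞ e := by
    refine ContMDiff.prodMk (ContDiff.contMDiff ?_) contMDiff_const
    refine contDiff_const.add (contDiff_pi.2 fun i => ?_)
    by_cases hi : i = j
    · subst hi; simp only [Pi.single_eq_same]; exact Complex.ofRealCLM.contDiff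
    · simpa [hi] using contDiff_const
  have he0 : e 0 = v := by simp [e]
  have hs0 : c'.chart.symm (e 0) = c.slice p := by
    rw [he0]; exact c'.chart.left_inv hp
  let O : Set ℝ := (fun w => c'.chart.symm (e w)) ⁻¹' c.chart.source
  have hO : IsOpen O := c.chart.open_source.preimage (c'.continuous_symm.comp he.continuous)
  have h0O : (0 : ℝ) ∈ O := by
    change c'.chart.symm (e 0) ∈ c.chart.source
    rw [hs0]; exact c.symm_mem_source _
  let γ : ℝ → StdSpace c.n c.l c.m := fun w => c.chart (c'.chart.symm (e w))
  have hγ : ContMDiffOn 𝓘(ℝ, ℝ) (stdModel c.n c.l c.m) ∞ γ O :=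
    c.contMDiffOn_chart.comp (c'.contMDiff_symm.comp he).contMDiffOn fun _ h => h
  have hγ0 : γ 0 = stdSlice p := by
    change c.chart (c'.chart.symm (e 0)) = _
    rw [hs0]; exact c.chart_symm _
  -- Forgetting the torus component moves the curve into the slice of `c` without leaving the
  -- orbits.
  let σ : ℝ → (Fin c.n → ℂ) × (Fin c.m → ℝ) := fun w => ((γ w).1, (γ w).2.2)
  have hσ : ContDiffOn ℝ ∞ σ O :=
    ((contMDiff_fst.comp_contMDiffOn hγ).contDiffOn).prodMk
      ((contMDiff_snd.comp_contMDiffOn (contMDiff_snd.comp_contMDiffOn hγ)).contDiffOn)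
  have hσ0 : σ 0 = p := by simp only [σ, hγ0]; rfl
  have hσd : DifferentiableAt ℝ σ 0 :=
    (hσ.contDiffAt (hO.mem_nhds h0O)).differentiableAt (by simp)
  have hFd : HasFDerivAt (fun p => (c.sliceTrans c' p).1 j) (0 : _ →L[ℝ] ℂ) (σ 0) := by
    rw [hσ0, ← hd]
    refine DifferentiableAt.hasFDerivAt ?_
    exact ((contDiffOn_pi.1 (c.contDiffOn_sliceTrans_fst c') j).contDiffAt
      ((c.isOpen_sliceOverlap c').mem_nhds hp)).differentiableAt (by simp)
  have hcomp := hFd.comp_hasDerivAt (0 : ℝ) hσd.hasDerivAt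
  rw [zero_apply] at hcomp
  -- The curves differ by the torus action, which preserves moduli of coordinates. So the coordinate
  -- along `σ` has modulus `|w|`, whereas a zero differential would make it `o(w)`.
  have hnorm : ∀ᶠ w in 𝓝 (0 : ℝ), ‖(c.sliceTrans c' (σ w)).1 j‖ = ‖w‖ := by
    filter_upwards [hO.mem_nhds h0O] with w hw
    have h1 : γ w = stdAct (1, (γ w).2.1) (stdSlice (σ w)) := by
      rw [stdAct_stdSlice]
      simp [σ, rotate_apply]
    have h2 : c'.chart.symm (e w) = c.split.symm (1, (γ w).2.1) • c.slice (σ w) := by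
      rw [slice, ← symm_stdAct', ← h1]
      exact (c.chart.left_inv hw).symm
    have h3 : c.slice (σ w) ∈ c'.chart.source := by
      rw [← c'.smul_mem_source_iff (c.split.symm (1, (γ w).2.1)), ← h2]
      exact c'.symm_mem_source _
    have h4 := congrArg c'.chart h2
    rw [c'.chart_symm, c'.map_smul _ _ h3] at h4
    have h5 := congrArg (fun u : StdSpace c'.n c'.l c'.m => ‖u.1 j‖) h4
    have h6 : v.1 j = 0 := h0
    simp only [stdAct, e, Pi.add_apply, h6, Pi.single_eq_same, zero_add, norm_mul, Circle.norm_coe,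
      one_mul, Complex.norm_real] at h5
    exact h5.symm
  have hlit := hcomp.isLittleO
  have h7 : (c.sliceTrans c' (σ 0)).1 j = 0 := by rw [hσ0]; exact h0
  simp only [Function.comp_apply, h7, sub_zero, smul_zero] at hlit
  have h8 : (fun w : ℝ => w) =o[𝓝 0] fun w : ℝ => w :=
    (Asymptotics.IsLittleO.norm_left hlit).congr' hnorm EventuallyEq.rfl |>.of_norm_left
  rw [Asymptotics.isLittleO_iff] at h8
  have h9 := h8 (by norm_num : (0 : ℝ) < 1 / 2)
  obtain ⟨r, hr, hball⟩ := Metric.eventually_nhds_iff.1 h9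
  have h10 := hball (y := r / 2) (by rw [Real.dist_eq, sub_zero, abs_of_pos (by linarith)]; linarith)
  rw [Real.norm_of_nonneg (by linarith)] at h10
  linarith

/-- The splitting of a chart lifts to a linear map of Lie algebras. -/
theorem exists_split_symm_lift (c : StandardChart I k M) :
    ∃ L : ((Fin c.n → ℝ) × (Fin c.l → ℝ)) →L[ℝ] (Fin k → ℝ), ∀ x,
      c.split.symm (torusExp x.1, torusExp x.2) = torusExp (L x) :=
  exists_linear_lift (χ := fun x : (Fin c.n → ℝ) × (Fin c.l → ℝ) =>
      c.split.symm (torusExp x.1, torusExp x.2))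
    (c.split.symm.continuous.comp ((continuous_torusExp.comp continuous_fst).prodMk
      (continuous_torusExp.comp continuous_snd)))
    (fun x y => by
      rw [← map_mul, Prod.fst_add, Prod.snd_add, torusExp_add, torusExp_add]; rfl)

/-- The standard sections of two standard charts differ by a torus-valued function which is smooth
up to the boundary. -/
theorem exists_localSection_eq (c c' : StandardChart I k M)
    {q₀ : (Fin c.n → ℝ) × (Fin c.m → ℝ)} (hq₀ : q₀ ∈ sector c.n c.m)
    (hs : c.localSection q₀ ∈ c'.chart.source) :
    ∃ (V : Set ((Fin c.n → ℝ) × (Fin c.m → ℝ)))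
      (κ : (Fin c.n → ℝ) × (Fin c.m → ℝ) → Fin k → ℝ), IsOpen V ∧ q₀ ∈ V ∧
      ContDiffOn ℝ ∞ κ (V ∩ sector c.n c.m) ∧ ∀ q ∈ V ∩ sector c.n c.m,
        c.localSection q ∈ c'.chart.source ∧ c.localSection q =
          torusExp (κ q) • c'.localSection (toCoord (c'.chart (c.localSection q))) := by
  classical
  have hq₀D : realIncl (sqrtMap q₀) ∈ c.sliceOverlap c' := hs
  set p₀ := realIncl (sqrtMap q₀) with hp₀
  have hC : ∀ j : Fin c'.n, _ := fun j => exists_contDiffOn_arg_of_equivariant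
    (F := fun p => (c.sliceTrans c' p).1 j)
    (c.isOpen_sliceOverlap c') (c.rotate_mem_sliceOverlap c')
    (contDiffOn_pi.1 (c.contDiffOn_sliceTrans_fst c') j)
    (fun t => ((c'.split (c.split.symm (t, 1))).1 j : ℂ))
    (fun t p hp => by rw [c.sliceTrans_rotate c' t hp]; rfl) hq₀ hq₀D (by
      by_cases h0 : (c.sliceTrans c' p₀).1 j = 0
      · refine Or.inr ⟨c.fderiv_sliceTrans_ne_zero c' hq₀D j h0, ?_⟩
        -- In `c'` this element changes the sign of a coordinate that vanishes at the point, so it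
        -- fixes the point. Read in `c`, it therefore has trivial `T^l` part and is trivial at every
        -- nonzero complex coordinate. Its `T^n` part is the required stabilizer element with
        -- character value `-1`.
        let τ : Torus k := c'.split.symm (signAt j, 1)
        have hτ : τ • c.slice p₀ = c.slice p₀ := by
          refine c'.chart.injOn (c'.smul_mem_source _ _ hq₀D) hq₀D ?_
          rw [c'.map_smul _ _ hq₀D, ContinuousMulEquiv.apply_symm_apply]
          refine Prod.ext (funext fun i => ?_) (Prod.ext (one_mul _) rfl)
          by_cases hi : i = j
          · subst hi
            have : (c'.chart (c.slice p₀)).1 i = 0 := h0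
            simp [stdAct, this]
          · simp [stdAct, signAt_ne hi]
        have h1 : stdAct (c.split τ) (stdSlice p₀) = (stdSlice p₀ : StdSpace c.n c.l c.m) := by
          have := congrArg c.chart hτ
          rwa [slice, c.map_smul _ _ (c.symm_mem_source _), chart_symm] at this
        have h2 : (c.split τ).2 = 1 := by
          have := congrArg (fun v : StdSpace c.n c.l c.m => v.2.1) h1
          simpa [stdAct, stdSlice] using this
        have h3 : c.split.symm ((c.split τ).1, 1) = τ := by
          rw [← h2]; exact c.split.symm_apply_apply τ
        refine ⟨(c.split τ).1, fun i hi => ?_, ?_⟩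
        · have h4 := congrFun (congrArg (fun v : StdSpace c.n c.l c.m => v.1) h1) i
          have h5 : p₀.1 i ≠ 0 := by
            simp only [hp₀, realIncl_apply, sqrtMap]
            exact_mod_cast (Real.sqrt_pos.2 ((hq₀ i).lt_of_ne' hi)).ne'
          have h6 : (((c.split τ).1 i : Circle) : ℂ) * p₀.1 i = 1 * p₀.1 i :=
            h4.trans (one_mul _).symm
          exact Circle.ext (by simpa using mul_right_cancel₀ h5 h6)
        · rw [h3, ContinuousMulEquiv.apply_symm_apply]
          exact signAt_self j
      · exact Or.inl h0)
  have hT : ∀ j : Fin c'.l, _ := fun j => exists_contDiffOn_arg_of_equivariant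
    (F := fun p => (((c.sliceTrans c' p).2.1 j : Circle) : ℂ))
    (c.isOpen_sliceOverlap c') (c.rotate_mem_sliceOverlap c')
    (c.contDiffOn_sliceTrans_torus c' j)
    (fun t => ((c'.split (c.split.symm (t, 1))).2 j : ℂ))
    (fun t p hp => by rw [c.sliceTrans_rotate c' t hp]; rfl) hq₀ hq₀D
    (Or.inl (Circle.coe_ne_zero _))
  choose VC θC hVC hqVC hθC hVθC using hC
  choose VT θT hVT hqVT hθT hVθT using hT
  obtain ⟨L, hL⟩ := c'.exists_split_symm_lift
  have hU : IsOpen ((fun q => realIncl (sqrtMap q)) ⁻¹' c.sliceOverlap c') :=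
    (c.isOpen_sliceOverlap c').preimage (realIncl.continuous.comp continuous_sqrtMap)
  refine ⟨((fun q => realIncl (sqrtMap q)) ⁻¹' c.sliceOverlap c') ∩ ((⋂ j, VC j) ∩ ⋂ j, VT j),
    fun q => L (fun j => θC j q, fun j => θT j q), hU.inter ((isOpen_iInter_of_finite hVC).inter
      (isOpen_iInter_of_finite hVT)), ⟨hq₀D, mem_iInter.2 hqVC, mem_iInter.2 hqVT⟩, ?_, ?_⟩
  · refine L.contDiff.comp_contDiffOn (ContDiffOn.prodMk (contDiffOn_pi.2 fun j => ?_)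
      (contDiffOn_pi.2 fun j => ?_))
    · exact (hθC j).mono fun q hq => ⟨mem_iInter.1 hq.1.2.1 j, hq.2⟩
    · exact (hθT j).mono fun q hq => ⟨mem_iInter.1 hq.1.2.2 j, hq.2⟩
  · rintro q ⟨⟨hqD, hqC, hqT⟩, hq⟩
    refine ⟨hqD, ?_⟩
    have h1 := eq_stdAct_stdSection_of_arg (c'.chart (c.localSection q))
      (torusExp fun j => θC j q, torusExp fun j => θT j q) (fun j => ?_)
        (funext fun j => Circle.ext ?_)
    · rw [← hL]
      refine (c'.chart.left_inv hqD).symm.trans ?_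
      exact (congrArg c'.chart.symm h1).trans (c'.symm_stdAct' _ _)
    · exact (hVθC j q ⟨mem_iInter.1 hqC j, hq⟩)
    · have := hVθT j q ⟨mem_iInter.1 hqT j, hq⟩
      rwa [Circle.norm_coe, Complex.ofReal_one, one_mul] at this

/-- The coordinates of one chart are smooth in the coordinates of another one. -/
theorem contDiffWithinAt_coord (c c' : StandardChart I k M)
    {q₀ : (Fin c.n → ℝ) × (Fin c.m → ℝ)} (hq₀ : q₀ ∈ sector c.n c.m)
    (hs : c.localSection q₀ ∈ c'.chart.source) :
    ContDiffWithinAt ℝ ∞ (fun q => toCoord (c'.chart (c.localSection q)))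
      (sector c.n c.m) q₀ := by
  -- Orbit coordinates are invariant under the torus, so they are even in every real coordinate of
  -- the slice.
  refine contDiffWithinAt_comp_sqrtMap
    (F := fun r => toCoord (c.sliceTrans c' (realIncl r)))
    ((c.isOpen_sliceOverlap c').preimage realIncl.continuous)
    (signInvariant_preimage_realIncl (c.rotate_mem_sliceOverlap c')) ?_ hq₀ hs ?_
  · have h1 : ContDiffOn ℝ ∞ (fun p => toCoord (c.sliceTrans c' p)) (c.sliceOverlap c') := by
      refine ContDiffOn.prodMk (contDiffOn_pi.2 fun i => ?_) (c.contDiffOn_sliceTrans_snd c')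
      exact (contDiffOn_pi.1 (c.contDiffOn_sliceTrans_fst c') i).norm_sq ℝ
    exact h1.comp realIncl.contDiff.contDiffOn fun _ h => h
  · intro i q hq
    simp only [realIncl_coordScale]
    rw [c.sliceTrans_rotate c' _ hq, toCoord_stdAct]

end StandardChart
end Charts

/-! ### The orbit space and its free part. -/

section OrbitSpace

/-- Every ultrafilter on a compact group converges. Properness is what makes the orbit space
Hausdorff. -/
theorem properSMul_of_compactSpace {G X : Type*} [TopologicalSpace G] [TopologicalSpace X]
    [Group G] [MulAction G X] [CompactSpace G] [ContinuousSMul G X] [T2Space X] :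
    ProperSMul G X := by
  refine properSMul_iff_continuousSMul_ultrafilter_tendsto_t2.2 ⟨inferInstance, fun 𝒰 _ _ _ => ?_⟩
  obtain ⟨g, -, hg⟩ := isCompact_univ.ultrafilter_le_nhds (𝒰.map Prod.fst) (by simp)
  exact ⟨g, hg⟩

variable {k : ℕ} {M : Type*} [MulAction (Torus k) M]

theorem orbitMap_eq_iff {x y : M} : orbitMap k x = orbitMap k y ↔ ∃ t : Torus k, t • y = x := by
  rw [orbitMap, orbitMap, Quotient.eq, MulAction.orbitRel_apply]; rfl

theorem orbitMap_smul (t : Torus k) (x : M) : orbitMap k (t • x) = orbitMap k x :=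
  orbitMap_eq_iff.2 ⟨t, rfl⟩

theorem orbitMap_out (p : OrbitSpace k M) : orbitMap k p.out = p := Quotient.out_eq p

variable (k M) in
/-- The points of the orbit space whose orbits are free. -/
def freeSet : Set (OrbitSpace k M) := {p | ∀ t : Torus k, t • p.out = p.out → t = 1}

theorem orbitMap_mem_freeSet {x : M} :
    orbitMap k x ∈ freeSet k M ↔ ∀ t : Torus k, t • x = x → t = 1 := by
  obtain ⟨u, hu⟩ := orbitMap_eq_iff.1 (orbitMap_out (orbitMap k x))
  have h : ∀ t : Torus k, t • (orbitMap k x).out = (orbitMap k x).out ↔ t • x = x := by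
    intro t
    rw [← hu, smul_comm t u x, smul_left_cancel_iff]
  simp only [freeSet, mem_ofPred_eq, h]

theorem smul_right_injective_of_mem_freeSet {x : M} (hx : orbitMap k x ∈ freeSet k M)
    {t u : Torus k} (h : t • x = u • x) : t = u := by
  have := orbitMap_mem_freeSet.1 hx (u⁻¹ * t) (by rw [mul_smul, h, inv_smul_smul])
  rwa [inv_mul_eq_one, eq_comm] at this

variable [TopologicalSpace M]

theorem isOpenQuotientMap_orbitMap [ContinuousSMul (Torus k) M] :
    IsOpenQuotientMap (orbitMap k : M → OrbitSpace k M) :=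
  MulAction.isOpenQuotientMap_quotientMk

theorem secondCountableTopology_orbitSpace [ContinuousSMul (Torus k) M]
    [SecondCountableTopology M] : SecondCountableTopology (OrbitSpace k M) :=
  TopologicalSpace.Quotient.secondCountableTopology isOpenMap_quotient_mk'_mul

end OrbitSpace

/-! ### Charts of the orbit space and lifts of a section. -/

section Charts

variable {E : Type*} [NormedAddCommGroup E] [NormedSpace ℝ E] {H : Type*} [TopologicalSpace H]
  {I : ModelWithCorners ℝ E H} {k : ℕ} {M : Type*} [TopologicalSpace M] [ChartedSpace H M]
  [MulAction (Torus k) M]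

namespace StandardChart

/-- The image of a chart domain in the orbit space. -/
def dom (c : StandardChart I k M) : Set (OrbitSpace k M) := {p | p.out ∈ c.chart.source}

/-- The coordinates of a chart, on the orbit space. -/
def coord (c : StandardChart I k M) (p : OrbitSpace k M) : (Fin c.n → ℝ) × (Fin c.m → ℝ) :=
  toCoord (c.chart p.out)

theorem orbitMap_mem_dom (c : StandardChart I k M) {x : M} :
    orbitMap k x ∈ c.dom ↔ x ∈ c.chart.source := by
  obtain ⟨u, hu⟩ := orbitMap_eq_iff.1 (orbitMap_out (orbitMap k x))
  rw [dom, mem_ofPred_eq, ← hu, c.smul_mem_source_iff]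

theorem coord_orbitMap (c : StandardChart I k M) {x : M} (hx : x ∈ c.chart.source) :
    c.coord (orbitMap k x) = toCoord (c.chart x) := by
  obtain ⟨u, hu⟩ := orbitMap_eq_iff.1 (orbitMap_out (orbitMap k x))
  rw [coord, ← hu, c.map_smul _ _ hx, toCoord_stdAct]

theorem coord_mem_sector (c : StandardChart I k M) (p : OrbitSpace k M) :
    c.coord p ∈ sector c.n c.m := toCoord_mem_sector _

theorem localSection_mem_source (c : StandardChart I k M) (q : (Fin c.n → ℝ) × (Fin c.m → ℝ)) :
    c.localSection q ∈ c.chart.source := c.symm_mem_source _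

theorem orbitPoint_mem_dom (c : StandardChart I k M) (q : (Fin c.n → ℝ) × (Fin c.m → ℝ)) :
    c.orbitPoint q ∈ c.dom := c.orbitMap_mem_dom.2 (c.localSection_mem_source q)

theorem coord_orbitPoint (c : StandardChart I k M) {q : (Fin c.n → ℝ) × (Fin c.m → ℝ)}
    (hq : q ∈ sector c.n c.m) : c.coord (c.orbitPoint q) = q := by
  rw [orbitPoint, c.coord_orbitMap (c.localSection_mem_source q), localSection, chart_symm,
    toCoord_stdSection hq]

theorem orbitPoint_toCoord (c : StandardChart I k M) {x : M} (hx : x ∈ c.chart.source) :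
    c.orbitPoint (toCoord (c.chart x)) = orbitMap k x := by
  obtain ⟨t, ht⟩ := exists_eq_stdAct_stdSection (c.chart x)
  refine (orbitMap_eq_iff.2 ⟨c.split.symm t, ?_⟩).symm
  rw [localSection, ← c.symm_stdAct', ← ht, c.chart.left_inv hx]

theorem orbitPoint_coord (c : StandardChart I k M) {p : OrbitSpace k M} (hp : p ∈ c.dom) :
    c.orbitPoint (c.coord p) = p :=
  (c.orbitPoint_toCoord hp).trans (orbitMap_out p)

theorem continuous_localSection (c : StandardChart I k M) : Continuous c.localSection :=
  c.continuous_symm.comp continuous_stdSection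

theorem continuous_orbitPoint (c : StandardChart I k M) : Continuous c.orbitPoint :=
  continuous_quot_mk.comp c.continuous_localSection

/-- The stabilizer of a point of the standard section consists of the circles of its vanishing
coordinates. Thus the interior of the sector has a description independent of the chart, and chart
changes preserve it. -/
theorem orbitPoint_mem_freeSet (c : StandardChart I k M) {q : (Fin c.n → ℝ) × (Fin c.m → ℝ)}
    (hq : q ∈ sector c.n c.m) : c.orbitPoint q ∈ freeSet k M ↔ q ∈ openSector c.n c.m := by
  have hfix : ∀ t : Torus k, t • c.localSection q = c.localSection q ↔
      stdAct (c.split t) (stdSection q) = (stdSection q : StdSpace c.n c.l c.m) := by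
    intro t
    rw [localSection, ← c.symm_stdAct]
    exact ⟨fun h => by simpa only [chart_symm] using congrArg c.chart h, fun h => by rw [h]⟩
  rw [orbitPoint, orbitMap_mem_freeSet]
  constructor
  · intro h i
    refine (hq i).lt_of_ne' fun hi => ?_
    have h1 := h (c.split.symm (signAt i, 1)) ((hfix _).2 (by
      rw [ContinuousMulEquiv.apply_symm_apply]
      refine Prod.ext (funext fun j => ?_) (Prod.ext (one_mul _) rfl)
      by_cases hj : j = i
      · subst hj; simp [stdAct, stdSection, hi]
      · simp [stdAct, signAt_ne hj]))
    rw [map_eq_one_iff _ c.split.symm.injective, Prod.mk_eq_one] at h1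
    have h2 := signAt_self i
    rw [h1.1] at h2
    norm_num at h2
  · intro h t ht
    have h1 := (hfix t).1 ht
    rw [← map_eq_one_iff _ c.split.injective, Prod.ext_iff]
    constructor
    · funext i
      have h2 := congrFun (congrArg (fun v : StdSpace c.n c.l c.m => v.1) h1) i
      have h3 : ((Real.sqrt (q.1 i) : ℝ) : ℂ) ≠ 0 := by
        exact_mod_cast (Real.sqrt_pos.2 (h i)).ne'
      have h4 : (((c.split t).1 i : Circle) : ℂ) * (Real.sqrt (q.1 i) : ℝ) =
        1 * (Real.sqrt (q.1 i) : ℝ) := h2.trans (one_mul _).symm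
      exact Circle.ext (by simpa using mul_right_cancel₀ h3 h4)
    · have := congrArg (fun v : StdSpace c.n c.l c.m => v.2.1) h1
      simpa [stdAct, stdSection] using this

theorem mem_closure_freeSet (c : StandardChart I k M) {q : (Fin c.n → ℝ) × (Fin c.m → ℝ)}
    (hq : q ∈ sector c.n c.m) : c.orbitPoint q ∈ closure (freeSet k M) := by
  rw [← closure_openSector] at hq
  exact map_mem_closure c.continuous_orbitPoint hq fun q hq =>
    (c.orbitPoint_mem_freeSet (openSector_subset_sector _ _ hq)).2 hq

/-- Over the free points of a chart domain, a continuous section has continuous arguments. -/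
theorem exists_section_lift (c : StandardChart I k M) {s : OrbitSpace k M → M}
    (hs : IsOrbitSection k s) :
    ∃ θ : (Fin c.n → ℝ) × (Fin c.m → ℝ) → Fin k → ℝ, ContinuousOn θ (openSector c.n c.m) ∧
      ∀ q ∈ openSector c.n c.m, s (c.orbitPoint q) = torusExp (θ q) • c.localSection q := by
  have hmem : ∀ q, s (c.orbitPoint q) ∈ c.chart.source := fun q => by
    rw [← c.orbitMap_mem_dom, hs.orbitMap_apply]
    exact c.orbitPoint_mem_dom q
  let v : (Fin c.n → ℝ) × (Fin c.m → ℝ) → StdSpace c.n c.l c.m := fun q =>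
    c.chart (s (c.orbitPoint q))
  have hv : Continuous v :=
    c.chart.continuousOn.comp_continuous (hs.continuous.comp c.continuous_orbitPoint) hmem
  have hvq : ∀ q ∈ sector c.n c.m, toCoord (v q) = q := fun q hq => by
    rw [← c.coord_orbitMap (hmem q), hs.orbitMap_apply, c.coord_orbitPoint hq]
  have hU := isOpen_openSector c.n c.m
  have hcv := convex_openSector c.n c.m
  have hne := nonempty_openSector c.n c.m
  -- In the interior the complex coordinates of the section have modulus `√x_j > 0`, and the
  -- interior is simply connected, so their logarithms exist.
  have hC : ∀ j, ∃ θ : (Fin c.n → ℝ) × (Fin c.m → ℝ) → ℝ, ContinuousOn θ (openSector c.n c.m) ∧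
      ∀ q ∈ openSector c.n c.m, (v q).1 j = ‖(v q).1 j‖ * (Circle.exp (θ q) : ℂ) := by
    intro j
    have hsc : IsSimplyConnected (openSector c.n c.m) := by
      have := hcv.contractibleSpace hne
      exact (inferInstance : SimplyConnectedSpace (openSector c.n c.m))
    obtain ⟨g, hg, hgv⟩ := Complex.exists_continuousOn_eqOn_exp_comp hsc hU
      (g := fun q => (v q).1 j) (by fun_prop) (by
        rintro ⟨q, hq, h0⟩
        have h1 := congrFun (congrArg Prod.fst (hvq q (openSector_subset_sector _ _ hq))) j
        simp only [toCoord, h0, norm_zero] at h1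
        have h2 := hq j
        rw [← h1] at h2
        norm_num at h2)
    refine ⟨fun q => (g q).im, Complex.continuous_im.comp_continuousOn hg, fun q hq => ?_⟩
    have h1 : Complex.exp (g q) = (v q).1 j := hgv hq
    rw [← h1, Complex.norm_exp, Circle.coe_exp, Complex.ofReal_exp, ← Complex.exp_add,
      Complex.re_add_im]
  choose θ₁ hθ₁ hvθ₁ using hC
  obtain ⟨θ₂, hθ₂, hvθ₂⟩ := exists_continuousOn_torus_lift hU hcv hne
    (f := fun q => (v q).2.1) (by fun_prop)
  obtain ⟨L, hL⟩ := c.exists_split_symm_lift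
  refine ⟨fun q => L (fun j => θ₁ j q, θ₂ q),
    L.continuous.comp_continuousOn ((continuousOn_pi.2 hθ₁).prodMk hθ₂), fun q hq => ?_⟩
  have h1 := eq_stdAct_stdSection_of_arg (v q) (torusExp fun j => θ₁ j q, torusExp (θ₂ q))
    (fun j => hvθ₁ j q hq) (hvθ₂ q hq)
  rw [hvq q (openSector_subset_sector _ _ hq)] at h1
  rw [← hL]
  refine (c.chart.left_inv (hmem q)).symm.trans ?_
  exact (congrArg c.chart.symm h1).trans (c.symm_stdAct' _ _)

variable [ContinuousSMul (Torus k) M]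

theorem isOpen_dom (c : StandardChart I k M) : IsOpen c.dom := by
  rw [← isOpenQuotientMap_orbitMap.isQuotientMap.isOpen_preimage]
  convert! c.chart.open_source
  ext x
  exact c.orbitMap_mem_dom

theorem continuousAt_coord (c : StandardChart I k M) {p : OrbitSpace k M} (hp : p ∈ c.dom) :
    ContinuousAt c.coord p := by
  rw [← orbitMap_out p] at hp ⊢
  have hx := c.orbitMap_mem_dom.1 hp
  rw [ContinuousAt, ← isOpenQuotientMap_orbitMap.map_nhds_eq, tendsto_map'_iff,
    c.coord_orbitMap hx]
  refine ((continuous_toCoord.tendsto _).comp (c.chart.continuousAt hx)).congr' ?_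
  filter_upwards [c.chart.open_source.mem_nhds hx] with y hy
  exact (c.coord_orbitMap hy).symm

/-- The coordinate ball of a chart in the orbit space. -/
def coordBall (c : StandardChart I k M) (p : OrbitSpace k M) (r : ℝ) : Set (OrbitSpace k M) :=
  {p' ∈ c.dom | c.coord p' ∈ Metric.ball (c.coord p) r}

theorem hasBasis_coordBall (c : StandardChart I k M) {p : OrbitSpace k M} (hp : p ∈ c.dom) :
    (𝓝 p).HasBasis (fun r : ℝ => 0 < r) (c.coordBall p) := by
  refine ⟨fun t => ⟨fun ht => ?_, ?_⟩⟩
  · rw [← c.orbitPoint_coord hp] at ht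
    obtain ⟨r, hr, h⟩ := Metric.mem_nhds_iff.1 (c.continuous_orbitPoint.continuousAt ht)
    exact ⟨r, hr, fun p' hp' => by rw [← c.orbitPoint_coord hp'.1]; exact h hp'.2⟩
  · rintro ⟨r, hr, h⟩
    refine mem_of_superset (inter_mem (c.isOpen_dom.mem_nhds hp)
      (c.continuousAt_coord hp (Metric.ball_mem_nhds _ hr))) h

end StandardChart
end Charts

/-! ### Gluing by averaging arguments. -/

section Gluing

variable {E : Type*} [NormedAddCommGroup E] [NormedSpace ℝ E] {H : Type*} [TopologicalSpace H]
  {I : ModelWithCorners ℝ E H} {k : ℕ} {M : Type*} [TopologicalSpace M] [ChartedSpace H M]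
  [MulAction (Torus k) M]

namespace StandardChart

/-- The function on the orbit space which is a bump function in the coordinates of a chart. -/
def bump (a : StandardChart I k M) {x₀ : (Fin a.n → ℝ) × (Fin a.m → ℝ)} (b : ContDiffBump x₀)
    (p : OrbitSpace k M) : ℝ :=
  a.dom.indicator (fun p => b (a.coord p)) p

theorem bump_nonneg (a : StandardChart I k M) {x₀ : (Fin a.n → ℝ) × (Fin a.m → ℝ)}
    (b : ContDiffBump x₀) (p : OrbitSpace k M) : 0 ≤ a.bump b p :=
  indicator_nonneg (fun _ _ => b.nonneg) p

theorem support_bump (a : StandardChart I k M) {x₀ : (Fin a.n → ℝ) × (Fin a.m → ℝ)}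
    (b : ContDiffBump x₀) :
    Function.support (a.bump b) = {p ∈ a.dom | a.coord p ∈ Metric.ball x₀ b.rOut} := by
  ext p
  rw [← b.support_eq]
  by_cases hp : p ∈ a.dom <;> simp [bump, hp]

/-- The support lies in the image of a compact ball, which is closed in a Hausdorff orbit space and
contained in the chart domain. Hence extension by zero creates no discontinuity. -/
theorem eventually_bump_eq_zero [T2Space (OrbitSpace k M)] (a : StandardChart I k M)
    {x₀ : (Fin a.n → ℝ) × (Fin a.m → ℝ)} (b : ContDiffBump x₀) {p : OrbitSpace k M}
    (hp : p ∉ a.dom) : ∀ᶠ p' in 𝓝 p, a.bump b p' = 0 := by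
  have hK : IsClosed (a.orbitPoint '' (Metric.closedBall x₀ b.rOut)) :=
    ((isCompact_closedBall x₀ b.rOut).image a.continuous_orbitPoint).isClosed
  have hpK : p ∉ a.orbitPoint '' (Metric.closedBall x₀ b.rOut) := by
    rintro ⟨q, _, rfl⟩
    exact hp (a.orbitPoint_mem_dom q)
  filter_upwards [hK.isOpen_compl.mem_nhds hpK] with p' hp'
  by_contra h
  have h1 : p' ∈ Function.support (a.bump b) := h
  rw [support_bump] at h1
  exact hp' ⟨a.coord p', Metric.ball_subset_closedBall h1.2, a.orbitPoint_coord h1.1⟩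

variable [ContinuousSMul (Torus k) M]

/-- The arguments of a section in two charts differ by a function which is smooth up to the
boundary. -/
theorem exists_contDiffOn_lift_sub (c a : StandardChart I k M) {s : OrbitSpace k M → M}
    {θ : (Fin c.n → ℝ) × (Fin c.m → ℝ) → Fin k → ℝ} (hθ : ContinuousOn θ (openSector c.n c.m))
    (hsθ : ∀ q ∈ openSector c.n c.m, s (c.orbitPoint q) = torusExp (θ q) • c.localSection q)
    {η : (Fin a.n → ℝ) × (Fin a.m → ℝ) → Fin k → ℝ} (hη : ContinuousOn η (openSector a.n a.m))
    (hsη : ∀ q ∈ openSector a.n a.m, s (a.orbitPoint q) = torusExp (η q) • a.localSection q)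
    {q₀ : (Fin c.n → ℝ) × (Fin c.m → ℝ)} (hq₀ : q₀ ∈ sector c.n c.m)
    (ha : c.orbitPoint q₀ ∈ a.dom) :
    ∃ (V : Set ((Fin c.n → ℝ) × (Fin c.m → ℝ)))
      (δ : (Fin c.n → ℝ) × (Fin c.m → ℝ) → Fin k → ℝ), IsOpen V ∧ q₀ ∈ V ∧
      ContDiffOn ℝ ∞ δ (V ∩ sector c.n c.m) ∧ ∀ q ∈ V ∩ openSector c.n c.m,
        η (a.coord (c.orbitPoint q)) - θ q = δ q := by
  obtain ⟨V, κ, hV, hqV, hκ, hVκ⟩ := c.exists_localSection_eq a hq₀ (a.orbitMap_mem_dom.1 ha)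
  obtain ⟨r, hr, hrV⟩ := Metric.mem_nhds_iff.1 (hV.mem_nhds hqV)
  -- Shrinking to a ball makes the interior part convex, hence connected.
  let S := Metric.ball q₀ r ∩ openSector c.n c.m
  have hSsub : S ⊆ V ∩ sector c.n c.m := fun q hq => ⟨hrV hq.1, openSector_subset_sector _ _ hq.2⟩
  have hSc : IsPreconnected S := ((convex_ball q₀ r).inter (convex_openSector _ _)).isPreconnected
  have hdom : ∀ q ∈ S, c.orbitPoint q ∈ a.dom := fun q hq =>
    a.orbitMap_mem_dom.2 (hVκ q (hSsub hq)).1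
  have hfree : ∀ q ∈ S, c.orbitPoint q ∈ freeSet k M := fun q hq =>
    (c.orbitPoint_mem_freeSet (hSsub hq).2).2 hq.2
  have hopen : ∀ q ∈ S, a.coord (c.orbitPoint q) ∈ openSector a.n a.m := fun q hq => by
    rw [← a.orbitPoint_mem_freeSet (a.coord_mem_sector _), a.orbitPoint_coord (hdom q hq)]
    exact hfree q hq
  -- On free orbits both expressions of the section determine the same torus element, so `f` has
  -- values in the period lattice and is constant on `S`. The difference of arguments is thus `κ`
  -- plus a constant.
  let f : (Fin c.n → ℝ) × (Fin c.m → ℝ) → Fin k → ℝ := fun q =>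
    η (a.coord (c.orbitPoint q)) + -(θ q + κ q)
  have hf : ContinuousOn f S := by
    refine ContinuousOn.add (hη.comp (fun q hq => ?_) hopen)
      ((hθ.mono inter_subset_right).add (hκ.continuousOn.mono hSsub)).neg
    exact ((a.continuousAt_coord (hdom q hq)).comp
      c.continuous_orbitPoint.continuousAt).continuousWithinAt
  have hf1 : ∀ q ∈ S, torusExp (f q) = 1 := by
    intro q hq
    have h1 := hsη _ (hopen q hq)
    have h2 := (hVκ q (hSsub hq)).2
    rw [← a.coord_orbitMap (hVκ q (hSsub hq)).1] at h2
    rw [a.orbitPoint_coord (hdom q hq), hsθ q hq.2, h2, ← mul_smul, ← torusExp_add] at h1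
    have h3 : orbitMap k (a.localSection (a.coord (c.orbitPoint q))) ∈ freeSet k M := by
      have := a.orbitPoint_coord (hdom q hq)
      rw [orbitPoint] at this
      rw [this]; exact hfree q hq
    rw [torusExp_add, torusExp_neg, smul_right_injective_of_mem_freeSet h3 h1, mul_inv_cancel]
  have hSne : S.Nonempty := by
    rw [← closure_openSector] at hq₀
    exact mem_closure_iff_nhds.1 hq₀ _ (Metric.ball_mem_nhds q₀ hr)
  obtain ⟨q₁, hq₁⟩ := hSne
  refine ⟨Metric.ball q₀ r, fun q => κ q + f q₁, Metric.isOpen_ball, Metric.mem_ball_self hr,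
    (hκ.mono (inter_subset_inter_left _ hrV)).add contDiffOn_const, fun q hq => ?_⟩
  rw [← constant_of_torusExp_eq_one hSc hf hf1 hq hq₁]
  simp only [f]; abel

/-- Inside the domain of `a` the coordinate change is smooth up to the boundary. Outside it the bump
function vanishes locally. -/
theorem contDiffOn_bump [T2Space (OrbitSpace k M)] (c a : StandardChart I k M)
    {x₀ : (Fin a.n → ℝ) × (Fin a.m → ℝ)} (b : ContDiffBump x₀) :
    ContDiffOn ℝ ∞ (fun q => a.bump b (c.orbitPoint q)) (sector c.n c.m) := by
  intro q hq
  by_cases hp : c.orbitPoint q ∈ a.dom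
  · have hs := a.orbitMap_mem_dom.1 hp
    have h1 := b.contDiff.contDiffAt.comp_contDiffWithinAt (n := ∞) q
      (c.contDiffWithinAt_coord a hq hs)
    have h2 : ∀ q, c.orbitPoint q ∈ a.dom → a.bump b (c.orbitPoint q) =
        b (toCoord (a.chart (c.localSection q))) := by
      intro q hq
      rw [bump, indicator_of_mem hq, orbitPoint, a.coord_orbitMap (a.orbitMap_mem_dom.1 hq)]
    refine h1.congr_of_eventuallyEq ?_ (h2 q hp)
    filter_upwards [mem_nhdsWithin_of_mem_nhds ((a.isOpen_dom.preimage
      c.continuous_orbitPoint).mem_nhds hp)] with q' hq'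
    exact h2 q' hq'
  · refine (contDiffWithinAt_const (c := (0 : ℝ))).congr_of_eventuallyEq ?_
      (a.eventually_bump_eq_zero b hp).self_of_nhds
    exact (c.continuous_orbitPoint.continuousAt.eventually
      (a.eventually_bump_eq_zero b hp)).filter_mono nhdsWithin_le_nhds

end StandardChart

variable [ContinuousSMul (Torus k) M]

/-- If a function on the free part of the orbit space is, in every chart, a smooth torus-valued
multiple of the standard section near every point of the sector, then it extends to a regular
section. -/
theorem exists_isRegular_of_local [T2Space M] {u : OrbitSpace k M → M}
    (hcover : ∀ x : M, ∃ c : StandardChart I k M, x ∈ c.chart.source)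
    (hu : ∀ (c : StandardChart I k M), ∀ q₀ ∈ sector c.n c.m,
      ∃ (V : Set ((Fin c.n → ℝ) × (Fin c.m → ℝ)))
        (μ : (Fin c.n → ℝ) × (Fin c.m → ℝ) → Fin k → ℝ), IsOpen V ∧ q₀ ∈ V ∧
        ContDiffOn ℝ ∞ μ (V ∩ sector c.n c.m) ∧ ∀ q ∈ V ∩ openSector c.n c.m,
          u (c.orbitPoint q) = torusExp (μ q) • c.localSection q) :
    ∃ s : OrbitSpace k M → M, IsOrbitSection k s ∧ IsRegular I s := by
  -- Only the values of `u` on the dense free part matter. The local formula is continuous up to the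
  -- boundary, so it supplies the limits that define `s`.
  let s := extendFrom (freeSet k M) u
  have key : ∀ (c : StandardChart I k M), ∀ q₀ ∈ sector c.n c.m,
      ∃ (V : Set ((Fin c.n → ℝ) × (Fin c.m → ℝ)))
        (μ : (Fin c.n → ℝ) × (Fin c.m → ℝ) → Fin k → ℝ), IsOpen V ∧ q₀ ∈ V ∧
        ContDiffOn ℝ ∞ μ (V ∩ sector c.n c.m) ∧
        (∀ p ∈ c.dom, c.coord p ∈ V →
          ContinuousAt (fun p => torusExp (μ (c.coord p)) • c.localSection (c.coord p)) p) ∧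
        ∀ q ∈ V ∩ sector c.n c.m,
          s (c.orbitPoint q) = torusExp (μ q) • c.localSection q := by
    intro c q₀ hq₀
    obtain ⟨V, μ, hV, hqV, hμ, hVμ⟩ := hu c q₀ hq₀
    have hcont : ∀ p ∈ c.dom, c.coord p ∈ V →
        ContinuousAt (fun p => torusExp (μ (c.coord p)) • c.localSection (c.coord p)) p := by
      intro p hp hpV
      have h1 : ContinuousAt c.coord p := c.continuousAt_coord hp
      have h2 : Tendsto c.coord (𝓝 p) (𝓝[V ∩ sector c.n c.m] (c.coord p)) :=
        tendsto_nhdsWithin_iff.2 ⟨h1, by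
          filter_upwards [h1 (hV.mem_nhds hpV)] with p' hp' using ⟨hp', c.coord_mem_sector p'⟩⟩
      have h3 : ContinuousAt (fun p => μ (c.coord p)) p :=
        (hμ.continuousOn _ ⟨hpV, c.coord_mem_sector p⟩).tendsto.comp h2
      exact (continuous_torusExp.continuousAt.comp h3).smul
        (c.continuous_localSection.continuousAt.comp h1)
    refine ⟨V, μ, hV, hqV, hμ, hcont, fun q hq => ?_⟩
    have hd := c.orbitPoint_mem_dom q
    have hq' := c.coord_orbitPoint hq.2
    have h1 := (hcont _ hd (by rw [hq']; exact hq.1)).tendsto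
    rw [hq'] at h1
    refine extendFrom_eq (c.mem_closure_freeSet hq.2)
      ((h1.mono_left nhdsWithin_le_nhds).congr' ?_)
    have h2 : ∀ᶠ p in 𝓝 (c.orbitPoint q), p ∈ c.dom ∧ c.coord p ∈ V :=
      (c.isOpen_dom.eventually_mem hd).and
        ((c.continuousAt_coord hd).eventually (hV.eventually_mem (by rw [hq']; exact hq.1)))
    filter_upwards [mem_nhdsWithin_of_mem_nhds h2, self_mem_nhdsWithin] with p hp hpf
    rw [← c.orbitPoint_coord hp.1, c.orbitPoint_mem_freeSet (c.coord_mem_sector p)] at hpf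
    rw [← hVμ _ ⟨hp.2, hpf⟩, c.orbitPoint_coord hp.1]
  refine ⟨s, ⟨continuous_iff_continuousAt.2 fun p => ?_, fun p => ?_⟩, fun p c q₀ hq₀ _ => ?_⟩
  · obtain ⟨c, hc⟩ := hcover p.out
    have hd : p ∈ c.dom := hc
    obtain ⟨V, μ, hV, hqV, -, hcont, hVμ⟩ := key c _ (c.coord_mem_sector p)
    refine (hcont p hd hqV).congr ?_
    filter_upwards [c.isOpen_dom.mem_nhds hd, c.continuousAt_coord hd (hV.mem_nhds hqV)]
      with p' hp' hpV
    rw [← hVμ _ ⟨hpV, c.coord_mem_sector p'⟩, c.orbitPoint_coord hp']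
  · obtain ⟨c, hc⟩ := hcover p.out
    have hd : p ∈ c.dom := hc
    obtain ⟨V, μ, hV, hqV, -, -, hVμ⟩ := key c _ (c.coord_mem_sector p)
    have h1 := hVμ _ ⟨hqV, c.coord_mem_sector p⟩
    rw [c.orbitPoint_coord hd] at h1
    rw [h1, orbitMap_smul]
    exact c.orbitPoint_coord hd
  · obtain ⟨V, μ, hV, hqV, hμ, -, hVμ⟩ := key c q₀ hq₀
    exact ⟨V, hV, hqV, fun q => torusExp (μ q), ContDiffOn.contMDiffOn_torusExp hμ, hVμ⟩

theorem exists_isRegular_section [T2Space M] [SecondCountableTopology M] [LocallyCompactSpace M]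
    (hcover : ∀ x : M, ∃ c : StandardChart I k M, x ∈ c.chart.source)
    {s : OrbitSpace k M → M} (hs : IsOrbitSection k s) :
    ∃ s : OrbitSpace k M → M, IsOrbitSection k s ∧ IsRegular I s := by
  classical
  have : ProperSMul (Torus k) M := properSMul_of_compactSpace
  have : T2Space (OrbitSpace k M) := t2Space_quotient_mulAction_of_properSMul
  have : LocallyCompactSpace (OrbitSpace k M) := isOpenQuotientMap_orbitMap.locallyCompactSpace
  have : SecondCountableTopology (OrbitSpace k M) := secondCountableTopology_orbitSpace
  choose ch hch using fun p : OrbitSpace k M => hcover p.out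
  obtain ⟨α, pt, r, hr, hcov, hfin⟩ := refinement_of_locallyCompact_sigmaCompact_of_nhds_basis
    fun p : OrbitSpace k M => (ch p).hasBasis_coordBall (hch p)
  let b : ∀ a : α, ContDiffBump ((ch (pt a)).coord (pt a)) := fun a =>
    ⟨r a / 2, r a, half_pos (hr a), half_lt_self (hr a)⟩
  let ρ : α → OrbitSpace k M → ℝ := fun a => (ch (pt a)).bump (b a)
  have hρ0 : ∀ a p, 0 ≤ ρ a p := fun a p => (ch (pt a)).bump_nonneg (b a) p
  have hsupp : ∀ a, Function.support (ρ a) = (ch (pt a)).coordBall (pt a) (r a) := fun a =>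
    (ch (pt a)).support_bump (b a)
  choose θ hθ hsθ using fun c : StandardChart I k M => c.exists_section_lift hs
  -- The bump functions do not sum to one, hence the division. The average is meaningful because the
  -- arguments are lifted to the vector space `ℝ^k`.
  let ψ : OrbitSpace k M → Fin k → ℝ := fun p =>
    (∑ᶠ a, ρ a p)⁻¹ • ∑ᶠ a, ρ a p • θ (ch (pt a)) ((ch (pt a)).coord p)
  refine exists_isRegular_of_local (u := fun p => torusExp (-ψ p) • s p) hcover fun c q₀ hq₀ => ?_
  obtain ⟨W₀, hW₀, hfin₀⟩ := hfin (c.orbitPoint q₀)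
  let T₀ : Finset α := hfin₀.toFinset
  let T : Finset α := T₀.filter fun a => c.orbitPoint q₀ ∈ (ch (pt a)).dom
  have hW : ∀ᶠ p in 𝓝 (c.orbitPoint q₀), ∀ a ∉ T, ρ a p = 0 := by
    have h1 : ∀ᶠ p in 𝓝 (c.orbitPoint q₀), ∀ a ∈ T₀, c.orbitPoint q₀ ∉ (ch (pt a)).dom →
        ρ a p = 0 := by
      rw [eventually_all_finset]
      intro a _
      by_cases h : c.orbitPoint q₀ ∈ (ch (pt a)).dom
      · exact Eventually.of_forall fun p hp => absurd h hp
      · filter_upwards [(ch (pt a)).eventually_bump_eq_zero (b a) h] with p hp _ using hp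
    filter_upwards [h1, hW₀] with p hp hpW a ha
    by_cases haT : a ∈ T₀
    · exact hp a haT fun h => ha (Finset.mem_filter.2 ⟨haT, h⟩)
    · by_contra hne
      refine haT (hfin₀.mem_toFinset.2 ⟨p, ?_, hpW⟩)
      change p ∈ (ch (pt a)).coordBall (pt a) (r a)
      rw [← hsupp]; exact hne
  obtain ⟨V₀, hV₀T, hV₀, hqV₀⟩ := eventually_nhds_iff.1
    (c.continuous_orbitPoint.continuousAt.eventually hW)
  choose V δ hV hqV hδ hVδ using fun a : T => c.exists_contDiffOn_lift_sub (ch (pt a)) (hθ c)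
    (hsθ c) (hθ (ch (pt a))) (hsθ (ch (pt a))) hq₀ (Finset.mem_filter.1 a.2).2
  have hsum : ∀ q ∈ V₀, ∑ᶠ a, ρ a (c.orbitPoint q) = ∑ a : T, ρ a (c.orbitPoint q) := by
    intro q hq
    rw [finsum_eq_sum_of_support_subset _ (s := T) (fun a ha => by
      by_contra h; exact ha (hV₀T q hq a h)), Finset.sum_coe_sort T fun a => ρ a (c.orbitPoint q)]
  have hpos : ∀ q ∈ V₀, 0 < ∑ a : T, ρ a (c.orbitPoint q) := by
    intro q hq
    obtain ⟨a, ha⟩ := mem_iUnion.1 (hcov.symm ▸ mem_univ (c.orbitPoint q))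
    rw [← hsupp] at ha
    have haT : a ∈ T := by
      by_contra h; exact ha (hV₀T q hq a h)
    exact Finset.sum_pos' (fun a _ => hρ0 a _)
      ⟨⟨a, haT⟩, Finset.mem_univ _, (hρ0 a _).lt_of_ne' ha⟩
  refine ⟨V₀ ∩ ⋂ a, V a, fun q => -((∑ a : T, ρ a (c.orbitPoint q))⁻¹ •
    ∑ a : T, ρ a (c.orbitPoint q) • δ a q), hV₀.inter (isOpen_iInter_of_finite hV),
    ⟨hqV₀, mem_iInter.2 hqV⟩, ?_, ?_⟩
  · have hρc : ∀ a, ContDiffOn ℝ ∞ (fun q => ρ a (c.orbitPoint q))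
        ((V₀ ∩ ⋂ a, V a) ∩ sector c.n c.m) := fun a =>
      (c.contDiffOn_bump (ch (pt a)) (b a)).mono inter_subset_right
    refine (ContDiffOn.smul (ContDiffOn.inv (ContDiffOn.sum fun (a : T) _ => hρc a) fun q hq =>
      (hpos q hq.1.1).ne') (ContDiffOn.sum fun (a : T) _ => (hρc a).smul ((hδ a).mono ?_))).neg
    exact fun q hq => ⟨mem_iInter.1 hq.1.2 a, hq.2⟩
  · rintro q ⟨⟨hq0, hqV'⟩, hq⟩
    have h1 : ψ (c.orbitPoint q) = (∑ a : T, ρ a (c.orbitPoint q))⁻¹ •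
        ∑ a : T, ρ a (c.orbitPoint q) • (δ a q + θ c q) := by
      simp only [ψ]
      rw [hsum q hq0]
      congr 1
      rw [finsum_eq_sum_of_support_subset _ (s := T) (fun a ha => by
        by_contra h; exact ha (by simp only [hV₀T q hq0 a h, zero_smul])),
        ← Finset.sum_coe_sort T]
      refine Finset.sum_congr rfl fun a _ => ?_
      rw [← hVδ a q ⟨mem_iInter.1 hqV' a, hq⟩, sub_add_cancel]
    -- The weights of the average sum to one, so the merely continuous `θ c` cancels and only the
    -- smooth differences `δ` remain.
    have h2 : -ψ (c.orbitPoint q) + θ c q = -((∑ a : T, ρ a (c.orbitPoint q))⁻¹ •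
        ∑ a : T, ρ a (c.orbitPoint q) • δ a q) := by
      simp only [h1, smul_add, Finset.sum_add_distrib, ← Finset.sum_smul]
      rw [smul_smul, inv_mul_cancel₀ (hpos q hq0).ne', one_smul]
      abel
    change torusExp (-ψ (c.orbitPoint q)) • s (c.orbitPoint q) = _
    rw [hsθ c q hq, ← mul_smul, ← torusExp_add, h2]

end Gluing

end LocallyStandardTorus

end

theorem mainTheorem3 {E : Type*} [NormedAddCommGroup E] [NormedSpace ℝ E] [FiniteDimensional ℝ E]
    {H : Type*} [TopologicalSpace H] (I : ModelWithCorners ℝ E H) [I.Boundaryless]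
    (k : ℕ) (M : Type*) [TopologicalSpace M] [T2Space M] [SecondCountableTopology M]
    [ChartedSpace H M] [IsManifold I ∞ M] [MulAction (LocallyStandardTorus.Torus k) M]
    (hM : LocallyStandardTorus.IsLocallyStandard I k M)
    (hs : ∃ s : LocallyStandardTorus.OrbitSpace k M → M,
      LocallyStandardTorus.IsOrbitSection k s) :
    ∃ s : LocallyStandardTorus.OrbitSpace k M → M,
      LocallyStandardTorus.IsOrbitSection k s ∧ LocallyStandardTorus.IsRegular I s := by
  obtain ⟨s, hs⟩ := hs
  have : ContinuousSMul (LocallyStandardTorus.Torus k) M := ⟨hM.contMDiff_smul.continuous⟩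
  have : LocallyCompactSpace M := Manifold.locallyCompact_of_finiteDimensional I
  exact LocallyStandardTorus.exists_isRegular_section hM.exists_chart hs
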